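/- Let $\mathbb K$ be $\mathbb R$ or $\mathbb C$. For a Lipschitz map $\varphi:[0,\infty)\to\mathbb K$ with $\varphi(0)=0$ define $\Omega_\varphi:c_{00}\to\ell_2$ by $$\Omega_\varphi(x)=\sum_{n} x_n\,\varphi\!\left(-\log\frac{|x_n|}{\|x\|_2}\right)e_n,\qquad \Omega_\varphi(0)=0,$$ and let $Z(\varphi)$ be the completion of $\ell_2\times c_{00}$ with respect to the quasi-norm $\|(y,x)\|_\varphi=\|y-\Omega_\varphi(x)\|_2+\|x\|_2$. Let $i:\ell_2\to Z(\varphi)$, $i(y)=(y,0)$, and let $q:Z(\varphi)\to\ell_2$ be the continuous extension of $(y,x)\mapsto x$. We say that $Z(\varphi)$ is a singular twisted Hilbert space if $Z(\varphi)$ is (isomorphic to) a Banach space, $0\to\ell_2\xrightarrow{\,i\,}Z(\varphi)\xrightarrow{\,q\,}\ell_2\to0$ is exact with $i$ an isomorphism onto its image and $q$ an open surjection, and $q$ is strictly singular (its restriction to any infinite-dimensional subspace is not an isomorphism onto the image). A map $\varphi$ is bi-Lipschitz if it is Lipschitz and there is $b>0$ with $|\varphi(s)-\varphi(t)|\ge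 b|s-t|$ for all $s,t\ge0$. Two spaces $X,Y$ are incomparable if neither is isomorphic to a subspace of the other. **Theorem.** There is a convex cone $\mathcal C$ of bi-Lipschitz maps $\varphi:[0,\infty)\to\mathbb K$ with $\varphi(0)=0$, generated by an infinite linearly independent set (that is, $\mathcal C$ is the smallest set containing an infinite set $B$ which is linearly independent over $\mathbb K$ and closed under addition and under multiplication by positive real numbers), such that for every $\varphi\in\mathcal C$ the space $Z(\varphi)$ is a singular twisted Hilbert space. Furthermore, if $\varphi,\psi\in\mathcal C$ and $\varphi$ is not a scalar multiple of $\psi$, then $Z(\varphi)$ and $Z(\psi)$ are incomparable. -/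

import Mathlib

open scoped NNReal ENNReal Topology Uniformity

noncomputable section

namespace TwistedHilbert

/-! ### Quasi-norms and the uniform structure they induce -/

/-- A quasi-norm on a `𝕜`-vector space. -/
structure QuasiNorm (𝕜 X : Type*) [RCLike 𝕜] [AddCommGroup X] [Module 𝕜 X] where
  toFun : X → ℝ
  nonneg' : ∀ x, 0 ≤ toFun x
  eq_zero_iff' : ∀ x, toFun x = 0 ↔ x = 0
  smul' : ∀ (c : 𝕜) (x : X), toFun (c • x) = ‖c‖ * toFun x
  add_le' : ∃ C : ℝ, 1 ≤ C ∧ ∀ x y, toFun (x + y) ≤ C * (toFun x + toFun y)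

namespace QuasiNorm

variable {𝕜 X : Type*} [RCLike 𝕜] [AddCommGroup X] [Module 𝕜 X] (N : QuasiNorm 𝕜 X)

theorem map_zero : N.toFun 0 = 0 := (N.eq_zero_iff' 0).2 rfl

theorem map_neg (x : X) : N.toFun (-x) = N.toFun x := by
  have h := N.smul' (-1) x
  simpa using h

/-- The entourages `{(x, y) | ‖x - y‖ < ε}`, for `ε > 0`. -/
def entourages : FilterBasis (X × X) where
  sets := {V | ∃ ε : ℝ, 0 < ε ∧ V = {p : X × X | N.toFun (p.1 - p.2) < ε}}
  nonempty := ⟨_, 1, one_pos, rfl⟩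
  inter_sets := by
    rintro _ _ ⟨ε, hε, rfl⟩ ⟨δ, hδ, rfl⟩
    refine ⟨_, ⟨min ε δ, lt_min hε hδ, rfl⟩, ?_⟩
    intro p hp
    have hp' : N.toFun (p.1 - p.2) < min ε δ := hp
    exact ⟨lt_of_lt_of_le hp' (min_le_left _ _), lt_of_lt_of_le hp' (min_le_right _ _)⟩

/-- The translation invariant uniform structure of a quasi-norm: the sets
`{(x, y) | ‖x - y‖ < ε}`, `ε > 0`, are a basis of entourages. -/
@[reducible]
def uniformSpace : UniformSpace X :=
  UniformSpace.ofCore <| UniformSpace.Core.mkOfBasis N.entourages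
    (by
      rintro _ ⟨ε, hε, rfl⟩ x
      simpa [N.map_zero] using hε)
    (by
      rintro _ ⟨ε, hε, rfl⟩
      refine ⟨_, ⟨ε, hε, rfl⟩, ?_⟩
      rintro ⟨x, y⟩ h
      have h' : N.toFun (x - y) < ε := h
      rw [← N.map_neg, neg_sub] at h'
      exact h')
    (by
      rintro _ ⟨ε, hε, rfl⟩
      obtain ⟨C, hC, hadd⟩ := N.add_le'
      refine ⟨_, ⟨ε / (2 * C), by positivity, rfl⟩, ?_⟩
      rintro ⟨x, z⟩ ⟨y, hxy, hyz⟩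
      have h1 : N.toFun (x - y) < ε / (2 * C) := hxy
      have h2 : N.toFun (y - z) < ε / (2 * C) := hyz
      have h3 := hadd (x - y) (y - z)
      rw [sub_add_sub_cancel] at h3
      have hC' : 0 < C := by linarith
      have h4 : C * (N.toFun (x - y) + N.toFun (y - z)) < C * (ε / (2 * C) + ε / (2 * C)) :=
        mul_lt_mul_of_pos_left (add_lt_add h1 h2) hC'
      have h5 : C * (ε / (2 * C) + ε / (2 * C)) = ε := by field_simp; ring
      change N.toFun (x - z) < ε
      linarith)

theorem hasBasis_uniformity :
    (@uniformity X N.uniformSpace).HasBasis (fun ε : ℝ => 0 < ε)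
      (fun ε => {p : X × X | N.toFun (p.1 - p.2) < ε}) := by
  constructor
  intro t
  change t ∈ N.entourages.filter ↔ _
  rw [N.entourages.mem_filter_iff]
  constructor
  · rintro ⟨_, ⟨ε, hε, rfl⟩, h⟩
    exact ⟨ε, hε, h⟩
  · rintro ⟨ε, hε, h⟩
    exact ⟨_, ⟨ε, hε, rfl⟩, h⟩

theorem isUniformAddGroup : @IsUniformAddGroup X N.uniformSpace _ := by
  let _ := N.uniformSpace
  refine ⟨?_⟩
  have hb := N.hasBasis_uniformity
  rw [UniformContinuous, uniformity_prod_eq_comap_prod,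
    ((hb.prod_self.comap _).tendsto_iff hb)]
  intro ε hε
  obtain ⟨C, hC, hadd⟩ := N.add_le'
  have hC' : 0 < C := by linarith
  refine ⟨ε / (2 * C), by positivity, ?_⟩
  rintro ⟨⟨a, b⟩, ⟨a', b'⟩⟩ h
  obtain ⟨h1, h2⟩ := h
  have h1 : N.toFun (a - a') < ε / (2 * C) := h1
  have h2 : N.toFun (b - b') < ε / (2 * C) := h2
  change N.toFun ((a - b) - (a' - b')) < ε
  have h3 := hadd (a - a') (-(b - b'))
  rw [N.map_neg] at h3
  have h4 : C * (N.toFun (a - a') + N.toFun (b - b')) < C * (ε / (2 * C) + ε / (2 * C)) :=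
    mul_lt_mul_of_pos_left (add_lt_add h1 h2) hC'
  have h5 : C * (ε / (2 * C) + ε / (2 * C)) = ε := by field_simp; ring
  have h6 : (a - b) - (a' - b') = (a - a') + -(b - b') := by abel
  rw [h6]
  linarith

theorem uniformContinuousConstSMul :
    @UniformContinuousConstSMul 𝕜 X N.uniformSpace _ := by
  let _ := N.uniformSpace
  refine ⟨fun c => ?_⟩
  have hb := N.hasBasis_uniformity
  rw [UniformContinuous, hb.tendsto_iff hb]
  intro ε hε
  refine ⟨ε / (‖c‖ + 1), by positivity, ?_⟩
  rintro ⟨a, b⟩ h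
  have h : N.toFun (a - b) < ε / (‖c‖ + 1) := h
  change N.toFun (c • a - c • b) < ε
  rw [← smul_sub, N.smul']
  rw [lt_div_iff₀ (by positivity)] at h
  nlinarith [N.nonneg' (a - b)]

end QuasiNorm

/-! ### Lipschitz maps -/

variable (𝕜 : Type*) [RCLike 𝕜]

/-- The `𝕜`-vector space of Lipschitz maps `φ : [0, ∞) → 𝕜` with `φ 0 = 0`. -/
def LipMap : Submodule 𝕜 (ℝ≥0 → 𝕜) where
  carrier := {φ | φ 0 = 0 ∧ ∃ K : ℝ≥0, LipschitzWith K φ}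
  zero_mem' := ⟨rfl, 0, LipschitzWith.const 0⟩
  add_mem' := by
    rintro φ ψ ⟨h0, K, hK⟩ ⟨h0', K', hK'⟩
    exact ⟨by simp [h0, h0'], K + K', hK.add hK'⟩
  smul_mem' := by
    rintro c φ ⟨h0, K, hK⟩
    exact ⟨by simp [h0], ‖c‖₊ * K, (lipschitzWith_smul c).comp hK⟩

variable {𝕜}

/-- A map `φ` (Lipschitz, with `φ 0 = 0`) is bi-Lipschitz: `|φ s - φ t| ≥ b |s - t|` for some
`b > 0`, the upper estimate being part of the type of `φ`. -/
def IsBiLipschitz (φ : LipMap 𝕜) : Prop :=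
  ∃ b : ℝ, 0 < b ∧ ∀ s t : ℝ≥0, b * dist s t ≤ dist ((φ : ℝ≥0 → 𝕜) s) ((φ : ℝ≥0 → 𝕜) t)

/-! ### The quasi-linear map `Ω_φ` -/

variable (𝕜) in
/-- The Hilbert space `ℓ₂` over `𝕜`. -/
abbrev L2 : Type _ := lp (fun _ : ℕ => 𝕜) 2

theorem memℓp_of_finite (f : ℕ → 𝕜) (hf : {n | f n ≠ 0}.Finite) : Memℓp f 2 :=
  (memℓp_zero hf).of_exponent_ge zero_le

variable (𝕜) in
/-- The inclusion `c₀₀ → ℓ₂`. -/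
def incl : (ℕ →₀ 𝕜) →ₗ[𝕜] L2 𝕜 where
  toFun x := ⟨fun n => x n, memℓp_of_finite x x.hasFiniteSupport⟩
  map_add' _ _ := rfl
  map_smul' _ _ := rfl

@[simp]
theorem incl_apply (x : ℕ →₀ 𝕜) (n : ℕ) : (incl 𝕜 x : ℕ → 𝕜) n = x n := rfl

theorem incl_eq_zero {x : ℕ →₀ 𝕜} (h : ‖incl 𝕜 x‖ = 0) : x = 0 := by
  rw [norm_eq_zero] at h
  ext n
  have := congrArg (fun f : L2 𝕜 => (f : ℕ → 𝕜) n) h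
  simpa using this

/-- `Ω_φ x = ∑ₙ xₙ φ (-log (|xₙ| / ‖x‖₂)) eₙ`, as a map `c₀₀ → ℓ₂`. Since `|xₙ| ≤ ‖x‖₂`, the
number `-log (|xₙ| / ‖x‖₂)` is nonnegative and `Real.toNNReal` only changes its type; the
terms with `xₙ = 0` vanish. -/
def Omega (φ : LipMap 𝕜) (x : ℕ →₀ 𝕜) : L2 𝕜 :=
  ⟨fun n => x n * (φ : ℝ≥0 → 𝕜) (Real.toNNReal (-Real.log (‖x n‖ / ‖incl 𝕜 x‖))),
    memℓp_of_finite _ (x.hasFiniteSupport.subset fun _ hn => left_ne_zero_of_mul hn)⟩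

theorem Omega_apply (φ : LipMap 𝕜) (x : ℕ →₀ 𝕜) (n : ℕ) :
    (Omega φ x : ℕ → 𝕜) n =
      x n * (φ : ℝ≥0 → 𝕜) (Real.toNNReal (-Real.log (‖x n‖ / ‖incl 𝕜 x‖))) := rfl

@[simp]
theorem Omega_zero (φ : LipMap 𝕜) : Omega φ 0 = 0 := by
  ext n
  simp [Omega_apply]

theorem Omega_smul (φ : LipMap 𝕜) (c : 𝕜) (x : ℕ →₀ 𝕜) :
    Omega φ (c • x) = c • Omega φ x := by
  rcases eq_or_ne c 0 with rfl | hc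
  · simp
  ext n
  have hc' : ‖c‖ ≠ 0 := by simpa using hc
  rw [lp.coeFn_smul, Pi.smul_apply, Omega_apply, Omega_apply, _root_.map_smul, norm_smul,
    Finsupp.smul_apply, norm_smul, mul_div_mul_left _ _ hc', smul_eq_mul, smul_eq_mul, mul_assoc]

theorem norm_le_of_coord {f g : L2 𝕜} {C : ℝ} (hC : 0 ≤ C)
    (h : ∀ n, ‖(f : ℕ → 𝕜) n‖ ≤ C * ‖(g : ℕ → 𝕜) n‖) : ‖f‖ ≤ C * ‖g‖ := by
  have hp : 0 < (2 : ℝ≥0∞).toReal := by norm_num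
  refine lp.norm_le_of_forall_sum_le hp (by positivity) fun s => ?_
  calc ∑ i ∈ s, ‖(f : ℕ → 𝕜) i‖ ^ (2 : ℝ≥0∞).toReal
      ≤ ∑ i ∈ s, C ^ (2 : ℝ≥0∞).toReal * ‖(g : ℕ → 𝕜) i‖ ^ (2 : ℝ≥0∞).toReal := by
        refine Finset.sum_le_sum fun i _ => ?_
        rw [← Real.mul_rpow hC (norm_nonneg _)]
        exact Real.rpow_le_rpow (norm_nonneg _) (h i) hp.le
    _ ≤ (C * ‖g‖) ^ (2 : ℝ≥0∞).toReal := by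
        rw [← Finset.mul_sum, Real.mul_rpow hC (norm_nonneg _)]
        exact mul_le_mul_of_nonneg_left (lp.sum_rpow_le_norm_rpow hp g s) (by positivity)

theorem lip_estimate (φ : LipMap 𝕜) {K : ℝ≥0} (hK : LipschitzWith K (φ : ℝ≥0 → 𝕜))
    (t : 𝕜) (u v : ℝ) :
    ‖t * (φ : ℝ≥0 → 𝕜) u.toNNReal - t * (φ : ℝ≥0 → 𝕜) v.toNNReal‖ ≤ K * (‖t‖ * |u - v|) := by
  rw [← mul_sub, norm_mul, ← dist_eq_norm]
  have h1 := hK.dist_le_mul u.toNNReal v.toNNReal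
  have h2 : dist u.toNNReal v.toNNReal ≤ |u - v| := by
    rw [NNReal.dist_eq, Real.coe_toNNReal', Real.coe_toNNReal']
    exact abs_max_sub_max_le_abs u v 0
  calc ‖t‖ * dist ((φ : ℝ≥0 → 𝕜) u.toNNReal) ((φ : ℝ≥0 → 𝕜) v.toNNReal)
      ≤ ‖t‖ * (K * |u - v|) := by gcongr; exact h1.trans (by gcongr)
    _ = K * (‖t‖ * |u - v|) := by ring

theorem scale_estimate {a b : ℝ} (ha : 0 < a) (hab : a ≤ b) {r : ℝ} (hr : 0 < r) :
    |-Real.log (r / a) - -Real.log (r / b)| ≤ b / a := by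
  have hb : 0 < b := ha.trans_le hab
  have h1 : -Real.log (r / a) - -Real.log (r / b) = -Real.log (b / a) := by
    rw [Real.log_div hr.ne' ha.ne', Real.log_div hr.ne' hb.ne', Real.log_div hb.ne' ha.ne']
    ring
  rw [h1, abs_neg, abs_of_nonneg (Real.log_nonneg ((one_le_div ha).2 hab))]
  exact Real.log_le_self (by positivity)

theorem coord_estimate (φ : LipMap 𝕜) {K : ℝ≥0} (hK : LipschitzWith K (φ : ℝ≥0 → 𝕜))
    {s m : ℝ} (hs : 0 < s) (t : 𝕜) (htm : ‖t‖ ≤ m) :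
    ‖t * (φ : ℝ≥0 → 𝕜) (Real.toNNReal (-Real.log (‖t‖ / s))) -
      t * (φ : ℝ≥0 → 𝕜) (Real.toNNReal (-Real.log (m / s)))‖ ≤ K * m := by
  rcases eq_or_ne t 0 with rfl | ht
  · simp only [zero_mul, sub_zero, norm_zero]
    exact mul_nonneg K.2 ((norm_nonneg _).trans htm)
  have ht' : 0 < ‖t‖ := norm_pos_iff.2 ht
  have hm : 0 < m := ht'.trans_le htm
  refine (lip_estimate φ hK t _ _).trans ?_
  gcongr
  have h1 : |-Real.log (‖t‖ / s) - -Real.log (m / s)| = Real.log (m / ‖t‖) := by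
    rw [Real.log_div ht'.ne' hs.ne', Real.log_div hm.ne' hs.ne', 
      ← abs_of_nonneg (Real.log_nonneg ((one_le_div ht').2 htm)), Real.log_div hm.ne' ht'.ne']
    congr 1
    ring
  rw [h1]
  calc ‖t‖ * Real.log (m / ‖t‖) ≤ ‖t‖ * (m / ‖t‖) := by
        gcongr
        exact Real.log_le_self (by positivity)
    _ = m := by field_simp

/-- `Ω_φ` with `‖x‖₂` replaced by a number `s`. -/
def OmegaAt (φ : LipMap 𝕜) (s : ℝ) (x : ℕ →₀ 𝕜) : L2 𝕜 :=
  ⟨fun n => x n * (φ : ℝ≥0 → 𝕜) (Real.toNNReal (-Real.log (‖x n‖ / s))),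
    memℓp_of_finite _ (x.hasFiniteSupport.subset fun _ hn => left_ne_zero_of_mul hn)⟩

theorem norm_Omega_sub_OmegaAt (φ : LipMap 𝕜) {K : ℝ≥0} (hK : LipschitzWith K (φ : ℝ≥0 → 𝕜))
    {s : ℝ} (hs : 0 < s) (x : ℕ →₀ 𝕜) (hx : ‖incl 𝕜 x‖ ≤ s) :
    ‖Omega φ x - OmegaAt φ s x‖ ≤ K * s := by
  rcases (norm_nonneg (incl 𝕜 x)).eq_or_lt with h0 | h0
  · obtain rfl := incl_eq_zero h0.symm
    have h1 : Omega φ (0 : ℕ →₀ 𝕜) - OmegaAt φ s 0 = 0 := by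
      ext n
      simp only [Omega_zero, OmegaAt, Finsupp.coe_zero, Pi.zero_apply, zero_mul, zero_sub]
      exact neg_zero
    rw [h1, norm_zero]
    positivity
  have h1 : ‖Omega φ x - OmegaAt φ s x‖ ≤ (K * (s / ‖incl 𝕜 x‖)) * ‖incl 𝕜 x‖ := by
    refine norm_le_of_coord (by positivity) fun n => ?_
    change ‖x n * _ - x n * _‖ ≤ _ * ‖x n‖
    rcases eq_or_ne (x n) 0 with h | h
    · simp [h]
    refine (lip_estimate φ hK _ _ _).trans ?_
    calc (K : ℝ) * (‖x n‖ * _) ≤ K * (‖x n‖ * (s / ‖incl 𝕜 x‖)) := by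
          gcongr
          exact scale_estimate h0 hx (norm_pos_iff.2 h)
      _ = K * (s / ‖incl 𝕜 x‖) * ‖x n‖ := by ring
  calc _ ≤ _ := h1
    _ = K * s := by field_simp

/-- The sequence `(|xₙ|)ₙ`. -/
def absVal (x : ℕ →₀ 𝕜) : ℕ →₀ 𝕜 :=
  x.mapRange (fun t => ((‖t‖ : ℝ) : 𝕜)) (by simp)

theorem norm_absVal (x : ℕ →₀ 𝕜) : ‖incl 𝕜 (absVal x)‖ ≤ ‖incl 𝕜 x‖ := by
  have := norm_le_of_coord (f := incl 𝕜 (absVal x)) (g := incl 𝕜 x) zero_le_one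
    (fun n => by simp [absVal])
  simpa using this

/-- `Ω_φ` is quasi-linear. -/
theorem Omega_quasilinear (φ : LipMap 𝕜) : ∃ C : ℝ, 0 ≤ C ∧ ∀ x y : ℕ →₀ 𝕜,
    ‖Omega φ (x + y) - Omega φ x - Omega φ y‖ ≤ C * (‖incl 𝕜 x‖ + ‖incl 𝕜 y‖) := by
  obtain ⟨-, K, hK⟩ := φ.2
  refine ⟨6 * K, by positivity, fun x y => ?_⟩
  set s := ‖incl 𝕜 x‖ + ‖incl 𝕜 y‖ with hs
  have hs0 : 0 ≤ s := by positivity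
  rcases hs0.eq_or_lt with h0 | h0
  · have hx : x = 0 := incl_eq_zero (by linarith [norm_nonneg (incl 𝕜 x), norm_nonneg (incl 𝕜 y)])
    have hy : y = 0 := incl_eq_zero (by linarith [norm_nonneg (incl 𝕜 x), norm_nonneg (incl 𝕜 y)])
    subst hx hy
    simpa using by positivity
  have hx := norm_Omega_sub_OmegaAt φ hK h0 x (by linarith [norm_nonneg (incl 𝕜 y)])
  have hy := norm_Omega_sub_OmegaAt φ hK h0 y (by linarith [norm_nonneg (incl 𝕜 x)])
  have hxy := norm_Omega_sub_OmegaAt φ hK h0 (x + y) (by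
    rw [map_add]
    exact norm_add_le _ _)
  have hmid : ‖OmegaAt φ s (x + y) - OmegaAt φ s x - OmegaAt φ s y‖ ≤ (3 * K) * s := by
    have h1 : ‖OmegaAt φ s (x + y) - OmegaAt φ s x - OmegaAt φ s y‖
        ≤ (3 * K) * ‖incl 𝕜 (absVal x + absVal y)‖ := by
      refine norm_le_of_coord (by positivity) fun n => ?_
      have hm : ‖(incl 𝕜 (absVal x + absVal y) : ℕ → 𝕜) n‖ = ‖x n‖ + ‖y n‖ := by
        rw [incl_apply, Finsupp.add_apply]
        change ‖((‖x n‖ : ℝ) : 𝕜) + ((‖y n‖ : ℝ) : 𝕜)‖ = _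
        rw [← RCLike.ofReal_add, RCLike.norm_ofReal, abs_of_nonneg (by positivity)]
      rw [hm]
      set m := ‖x n‖ + ‖y n‖
      have e1 := coord_estimate φ hK h0 (x n) (m := m) (by simp [m])
      have e2 := coord_estimate φ hK h0 (y n) (m := m) (by simp [m])
      have e3 := coord_estimate φ hK h0 (x n + y n) (m := m) (norm_add_le _ _)
      set P := (φ : ℝ≥0 → 𝕜) (Real.toNNReal (-Real.log (m / s)))
      set A := x n * (φ : ℝ≥0 → 𝕜) (Real.toNNReal (-Real.log (‖x n‖ / s)))
      set B := y n * (φ : ℝ≥0 → 𝕜) (Real.toNNReal (-Real.log (‖y n‖ / s)))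
      set D := (x n + y n) * (φ : ℝ≥0 → 𝕜) (Real.toNNReal (-Real.log (‖x n + y n‖ / s)))
      change ‖D - A - B‖ ≤ _
      have e : D - A - B = (D - (x n + y n) * P) - (A - x n * P) - (B - y n * P) := by ring
      rw [e]
      have n1 := norm_sub_le (D - (x n + y n) * P - (A - x n * P)) (B - y n * P)
      have n2 := norm_sub_le (D - (x n + y n) * P) (A - x n * P)
      linarith
    refine h1.trans ?_
    gcongr
    rw [map_add]
    exact (norm_add_le _ _).trans (add_le_add (norm_absVal x) (norm_absVal y))
  have e : Omega φ (x + y) - Omega φ x - Omega φ y =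
      (Omega φ (x + y) - OmegaAt φ s (x + y)) - (Omega φ x - OmegaAt φ s x)
        - (Omega φ y - OmegaAt φ s y)
        + (OmegaAt φ s (x + y) - OmegaAt φ s x - OmegaAt φ s y) := by abel
  rw [e]
  refine (norm_add_le _ _).trans ?_
  have n1 := norm_sub_le (Omega φ (x + y) - OmegaAt φ s (x + y) - (Omega φ x - OmegaAt φ s x))
    (Omega φ y - OmegaAt φ s y)
  have n2 := norm_sub_le (Omega φ (x + y) - OmegaAt φ s (x + y)) (Omega φ x - OmegaAt φ s x)
  linarith

/-! ### The twisted Hilbert space `Z(φ)` -/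

/-- The vector space `ℓ₂ × c₀₀`, to be equipped with the quasi-norm `‖·‖_φ`. -/
def PreZ (_φ : LipMap 𝕜) : Type _ := L2 𝕜 × (ℕ →₀ 𝕜)

instance (φ : LipMap 𝕜) : AddCommGroup (PreZ φ) :=
  inferInstanceAs (AddCommGroup (L2 𝕜 × (ℕ →₀ 𝕜)))

instance (φ : LipMap 𝕜) : Module 𝕜 (PreZ φ) :=
  inferInstanceAs (Module 𝕜 (L2 𝕜 × (ℕ →₀ 𝕜)))

/-- The element `(y, x)` of `ℓ₂ × c₀₀`. -/
def PreZ.mk (φ : LipMap 𝕜) (y : L2 𝕜) (x : ℕ →₀ 𝕜) : PreZ φ := (y, x)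

/-- The quasi-norm `‖(y, x)‖_φ = ‖y - Ω_φ x‖₂ + ‖x‖₂` on `ℓ₂ × c₀₀`. -/
def quasiNorm (φ : LipMap 𝕜) : QuasiNorm 𝕜 (PreZ φ) where
  toFun z := ‖z.1 - Omega φ z.2‖ + ‖incl 𝕜 z.2‖
  nonneg' _ := by positivity
  eq_zero_iff' := by
    rintro ⟨y, x⟩
    constructor
    · intro h
      have h1 : ‖y - Omega φ x‖ + ‖incl 𝕜 x‖ = 0 := h
      have hx : x = 0 := incl_eq_zero (by
        linarith [norm_nonneg (incl 𝕜 x), norm_nonneg (y - Omega φ x)])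
      subst hx
      have hy : y = 0 := by simpa using h1
      subst hy
      rfl
    · intro h
      have hy : y = 0 := congrArg Prod.fst h
      have hx : x = 0 := congrArg Prod.snd h
      subst hy hx
      simp
  smul' := by
    rintro c ⟨y, x⟩
    change ‖c • y - Omega φ (c • x)‖ + ‖incl 𝕜 (c • x)‖
      = ‖c‖ * (‖y - Omega φ x‖ + ‖incl 𝕜 x‖)
    rw [Omega_smul, ← smul_sub, norm_smul, _root_.map_smul, norm_smul, mul_add]
  add_le' := by
    obtain ⟨C, hC, h⟩ := Omega_quasilinear φ
    refine ⟨C + 1, by linarith, ?_⟩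
    rintro ⟨y, x⟩ ⟨y', x'⟩
    change ‖(y + y') - Omega φ (x + x')‖ + ‖incl 𝕜 (x + x')‖
      ≤ (C + 1) * ((‖y - Omega φ x‖ + ‖incl 𝕜 x‖) + (‖y' - Omega φ x'‖ + ‖incl 𝕜 x'‖))
    have e : (y + y') - Omega φ (x + x') = ((y - Omega φ x) + (y' - Omega φ x'))
        - (Omega φ (x + x') - Omega φ x - Omega φ x') := by abel
    have h1 := norm_sub_le ((y - Omega φ x) + (y' - Omega φ x'))
      (Omega φ (x + x') - Omega φ x - Omega φ x')
    have h2 := norm_add_le (y - Omega φ x) (y' - Omega φ x')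
    have h3 : ‖incl 𝕜 (x + x')‖ ≤ ‖incl 𝕜 x‖ + ‖incl 𝕜 x'‖ := by
      rw [map_add]
      exact norm_add_le _ _
    have h4 := h x x'
    rw [e]
    nlinarith [norm_nonneg (y - Omega φ x), norm_nonneg (y' - Omega φ x')]

instance (φ : LipMap 𝕜) : UniformSpace (PreZ φ) := (quasiNorm φ).uniformSpace

instance (φ : LipMap 𝕜) : IsUniformAddGroup (PreZ φ) := (quasiNorm φ).isUniformAddGroup

instance (φ : LipMap 𝕜) : UniformContinuousConstSMul 𝕜 (PreZ φ) :=
  (quasiNorm φ).uniformContinuousConstSMul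

/-- `Z(φ)`, the completion of `(ℓ₂ × c₀₀, ‖·‖_φ)`. -/
abbrev Z (φ : LipMap 𝕜) : Type _ := UniformSpace.Completion (PreZ φ)

/-- The canonical map of `(ℓ₂ × c₀₀, ‖·‖_φ)` into its completion `Z(φ)`. -/
def toZ (φ : LipMap 𝕜) : PreZ φ →L[𝕜] Z φ where
  toFun z := (z : UniformSpace.Completion (PreZ φ))
  map_add' := UniformSpace.Completion.coe_add
  map_smul' := UniformSpace.Completion.coe_smul
  cont := UniformSpace.Completion.continuous_coe _

/-- A linear map `T` with `‖T z‖ ≤ ‖z‖_φ` is continuous. -/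
theorem continuous_of_le_quasiNorm (φ : LipMap 𝕜) {E : Type*} [SeminormedAddCommGroup E]
    [Module 𝕜 E] (T : PreZ φ →ₗ[𝕜] E) (h : ∀ z, ‖T z‖ ≤ (quasiNorm φ).toFun z) :
    Continuous T := by
  have hT : UniformContinuous T := by
    rw [UniformContinuous, (quasiNorm φ).hasBasis_uniformity.tendsto_iff
      Metric.uniformity_basis_dist]
    intro ε hε
    refine ⟨ε, hε, ?_⟩
    rintro ⟨a, b⟩ hab
    have hab : (quasiNorm φ).toFun (a - b) < ε := hab
    change dist (T a) (T b) < ε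
    rw [dist_eq_norm, ← map_sub]
    exact (h _).trans_lt hab
  exact hT.continuous

/-- The map `ℓ₂ → ℓ₂ × c₀₀`, `y ↦ (y, 0)`. -/
def preI (φ : LipMap 𝕜) : L2 𝕜 →L[𝕜] PreZ φ where
  toFun y := PreZ.mk φ y 0
  map_add' := (LinearMap.inl 𝕜 (L2 𝕜) (ℕ →₀ 𝕜)).map_add
  map_smul' := (LinearMap.inl 𝕜 (L2 𝕜) (ℕ →₀ 𝕜)).map_smul
  cont := by
    have h : UniformContinuous (fun y : L2 𝕜 => PreZ.mk φ y 0) := by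
      rw [UniformContinuous, Metric.uniformity_basis_dist.tendsto_iff (quasiNorm φ).hasBasis_uniformity]
      intro ε hε
      refine ⟨ε, hε, ?_⟩
      rintro ⟨a, b⟩ hab
      have hab : dist a b < ε := hab
      change ‖(a - b) - Omega φ (0 - 0)‖ + ‖incl 𝕜 (0 - 0)‖ < ε
      rw [dist_eq_norm] at hab
      simpa using hab
    exact h.continuous

/-- The embedding `i : ℓ₂ → Z(φ)`, `i y = (y, 0)`. -/
def iMap (φ : LipMap 𝕜) : L2 𝕜 →L[𝕜] Z φ := (toZ φ).comp (preI φ)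

/-- The map `ℓ₂ × c₀₀ → ℓ₂`, `(y, x) ↦ x`. -/
def preQ (φ : LipMap 𝕜) : PreZ φ →L[𝕜] L2 𝕜 where
  toFun z := incl 𝕜 z.2
  map_add' z w := map_add (incl 𝕜) z.2 w.2
  map_smul' c z := (incl 𝕜).map_smul c z.2
  cont := continuous_of_le_quasiNorm φ
    { toFun := fun z => incl 𝕜 z.2
      map_add' := fun z w => map_add (incl 𝕜) z.2 w.2
      map_smul' := fun c z => (incl 𝕜).map_smul c z.2 }
    (fun _ => le_add_of_nonneg_left (norm_nonneg _))

/-- The quotient map `q : Z(φ) → ℓ₂`, the continuous extension of `(y, x) ↦ x`. -/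
def qMap (φ : LipMap 𝕜) : Z φ →L[𝕜] L2 𝕜 := (preQ φ).extend (toZ φ)

theorem qMap_toZ (φ : LipMap 𝕜) (z : PreZ φ) : qMap φ (toZ φ z) = incl 𝕜 z.2 :=
  (preQ φ).extend_eq UniformSpace.Completion.denseRange_coe
    (UniformSpace.Completion.isUniformInducing_coe _) z

/-! ### Singular twisted Hilbert spaces and incomparability -/

section TVS

variable (𝕜)
variable (X Y : Type*) [AddCommGroup X] [Module 𝕜 X] [TopologicalSpace X]
  [AddCommGroup Y] [Module 𝕜 Y] [TopologicalSpace Y]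

/-- `X` is a Banach space up to isomorphism: it is linearly homeomorphic to a Banach space. -/
def IsBanachable.{u} (𝕜 : Type u) [RCLike 𝕜] (X : Type u) [AddCommGroup X] [Module 𝕜 X]
    [TopologicalSpace X] : Prop :=
  ∃ (E : Type u) (_ : NormedAddCommGroup E) (_ : NormedSpace 𝕜 E) (_ : CompleteSpace E),
    Nonempty (X ≃L[𝕜] E)

/-- `X` is isomorphic to a subspace of `Y`. -/
def EmbedsInto : Prop :=
  ∃ T : X →L[𝕜] Y, Topology.IsEmbedding T

/-- `X` and `Y` are incomparable: neither is isomorphic to a subspace of the other. -/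
def Incomparable : Prop :=
  ¬ EmbedsInto 𝕜 X Y ∧ ¬ EmbedsInto 𝕜 Y X

variable {𝕜 X Y}

/-- `T` is strictly singular: there is no infinite-dimensional subspace of `X` on which `T` is an
isomorphism onto its image. -/
def StrictlySingular (T : X →L[𝕜] Y) : Prop :=
  ∀ W : Submodule 𝕜 X, ¬ FiniteDimensional 𝕜 W → ¬ Topology.IsEmbedding (fun w : W => T w)

end TVS

/-- The Banach space `X` is a twisted Hilbert space through `i` and `q`: the sequence
`0 → ℓ₂ → X → ℓ₂ → 0` is exact, `i` is an isomorphism onto its image, and `q` induces an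
isomorphism `X / i(ℓ₂) ≅ ℓ₂`. -/
structure IsTwistedHilbert.{u} {𝕜 X : Type u} [RCLike 𝕜] [AddCommGroup X] [Module 𝕜 X]
    [TopologicalSpace X] (i : L2 𝕜 →L[𝕜] X) (q : X →L[𝕜] L2 𝕜) : Prop where
  isBanachable : IsBanachable 𝕜 X
  isEmbedding : Topology.IsEmbedding i
  exact : Set.range i = {x | q x = 0}
  surjective : Function.Surjective q
  isOpenMap : IsOpenMap q

/-- `Z(φ)` is a singular twisted Hilbert space: a twisted Hilbert space through the canonical `i`
and `q`, with `q` strictly singular. -/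
def IsSingularTwistedHilbert (φ : LipMap 𝕜) : Prop :=
  IsTwistedHilbert (iMap φ) (qMap φ) ∧ StrictlySingular (qMap φ)

/-! ### Infinite-dimensional cones -/

/-- A convex cone of maps is infinite-dimensional: it is the convex cone generated by an infinite
linearly independent set. -/
def IsInfiniteDimensionalCone (C : ConvexCone ℝ (LipMap 𝕜)) : Prop :=
  ∃ B : Set (LipMap 𝕜), B.Infinite ∧ LinearIndepOn 𝕜 id B ∧ C = ConvexCone.hull ℝ B

end TwistedHilbert

end

/-! The cone is generated by the maps `t + log(1+t)^(k+1)`. Each of its members is `p(1) t +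
p(log(1+t))` for a real polynomial `p` with `p(0) = 0`: a linear map plus an increasing perturbation
that is unbounded but sublinear. Three arguments carry the theorem.

Banach space. `Ω_φ` is additive up to `4K ∑ ‖x_i‖` for sums of any length (`Omega_sum`), not only
for two summands. Hence `‖·‖_φ` is equivalent to the largest seminorm below it, and `Z(φ)` is the
completion of a normed space.

Singularity. Suppose that sums of any `N` far-out terms of `(y_k, x_k)` in `Z(ψ)`, with unimodular
coefficients, are at most `C √N`. Then `x_k → 0` coordinatewise, so along suitable `N`-element sets
`Ω` computed at the scale `√N` is almost additive. A choice of signs then bounds `‖y_k - Ω_{√N}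
x_k‖` independently of `N`. The same `y_k` thus lies near `Ω_{√N} x_k` for all `N`, whereas for
bi-Lipschitz `ψ` these vectors move apart like `log √M ‖x_k‖` from the scale `√N` to the scale
`√(NM)`. So `x_k → 0` in norm (`tendsto_qMap_zero`). Lifting an orthonormal sequence shows that `q`
is strictly singular.

Incomparability. Let `T` embed `Z(φ)` into `Z(ψ)`. By the previous argument `T(e_k, 0)` is
asymptotically some `(z_k, 0)`; approximate `T(0, e_k)` by `(y_k, x_k)`. A sum `u` of `N` unit
vectors satisfies `Ω_φ u = φ(log √N) u`, so the vectors `(y_k + φ(log √N) z_k, x_k)` have flat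
estimates with a constant independent of `N`. Comparing scales `√N` and `1` makes `φ(log √N) z_k`
close to `Ω_{√N} x_k - Ω_1 x_k`. At a well-chosen coordinate this reads `l φ(σ) ≈ ψ(σ + c) - ψ(c)`,
`σ = log √N`, for any prescribed finite set of `N` and some `c` bounded below
(`exists_shift_approx`). For large `c` the right side is almost linear, and for bounded `c` it is
`ψ(σ)` up to a constant. Neither is within bounded distance of a multiple of `φ` in the cone, unless
`φ` is a multiple of `ψ` (`IsLogPoly.not_embedsInto`). -/

noncomputable section

namespace TwistedHilbert

variable {𝕜 : Type*} [RCLike 𝕜]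

/-! ### The norm generated by a quasi-norm -/

namespace QuasiNorm

variable {X : Type*} [AddCommGroup X] [Module 𝕜 X] (N : QuasiNorm 𝕜 X)

/-- The values `∑ N (fᵢ)` over all finite decompositions `z = ∑ fᵢ`. -/
def decompSums (z : X) : Set ℝ :=
  {r | ∃ (n : ℕ) (f : Fin n → X), ∑ i, f i = z ∧ ∑ i, N.toFun (f i) = r}

/-- The largest seminorm below a quasi-norm. -/
def envelope (z : X) : ℝ := sInf (N.decompSums z)

theorem mem_decompSums (z : X) : N.toFun z ∈ N.decompSums z :=
  ⟨1, fun _ => z, by simp, by simp⟩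

theorem nonneg_of_mem_decompSums {z : X} {r : ℝ} (h : r ∈ N.decompSums z) : 0 ≤ r := by
  obtain ⟨n, f, -, rfl⟩ := h
  exact Finset.sum_nonneg fun i _ => N.nonneg' _

theorem bddBelow_decompSums (z : X) : BddBelow (N.decompSums z) :=
  ⟨0, fun _ h => N.nonneg_of_mem_decompSums h⟩

theorem envelope_le (z : X) : N.envelope z ≤ N.toFun z :=
  csInf_le (N.bddBelow_decompSums z) (N.mem_decompSums z)

theorem envelope_nonneg (z : X) : 0 ≤ N.envelope z :=
  le_csInf ⟨_, N.mem_decompSums z⟩ fun _ h => N.nonneg_of_mem_decompSums h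

theorem envelope_add_le (z w : X) : N.envelope (z + w) ≤ N.envelope z + N.envelope w := by
  rw [← sub_le_iff_le_add]
  refine le_csInf ⟨_, N.mem_decompSums z⟩ ?_
  rintro _ ⟨n, f, rfl, rfl⟩
  rw [sub_le_comm]
  refine le_csInf ⟨_, N.mem_decompSums w⟩ ?_
  rintro _ ⟨m, g, rfl, rfl⟩
  rw [sub_le_iff_le_add']
  refine csInf_le (N.bddBelow_decompSums _) ⟨n + m, Fin.append f g, ?_, ?_⟩
  · simp [Fin.sum_univ_add]
  · simp [Fin.sum_univ_add]

theorem envelope_smul_le (c : 𝕜) (z : X) : N.envelope (c • z) ≤ ‖c‖ * N.envelope z := by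
  rcases eq_or_ne c 0 with rfl | hc
  · simpa [N.map_zero] using N.envelope_le (0 : X)
  have hc' : 0 < ‖c‖ := norm_pos_iff.2 hc
  rw [← div_le_iff₀' hc']
  refine le_csInf ⟨_, N.mem_decompSums z⟩ ?_
  rintro _ ⟨n, f, rfl, rfl⟩
  rw [div_le_iff₀' hc']
  refine csInf_le (N.bddBelow_decompSums _) ⟨n, fun i => c • f i, ?_, ?_⟩
  · rw [Finset.smul_sum]
  · simp [N.smul', Finset.mul_sum]

theorem envelope_smul (c : 𝕜) (z : X) : N.envelope (c • z) = ‖c‖ * N.envelope z := by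
  refine le_antisymm (N.envelope_smul_le c z) ?_
  rcases eq_or_ne c 0 with rfl | hc
  · simpa using N.envelope_nonneg _
  have h := N.envelope_smul_le c⁻¹ (c • z)
  rw [inv_smul_smul₀ hc, norm_inv] at h
  rwa [inv_mul_eq_div, le_div_iff₀' (norm_pos_iff.2 hc)] at h

/-- The criterion for local convexity: the constant must not depend on the number of summands. -/
theorem le_envelope {C : ℝ} (hC : 0 < C)
    (h : ∀ (n : ℕ) (f : Fin n → X), N.toFun (∑ i, f i) ≤ C * ∑ i, N.toFun (f i)) (z : X) :
    N.toFun z ≤ C * N.envelope z := by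
  rw [← div_le_iff₀' hC]
  refine le_csInf ⟨_, N.mem_decompSums z⟩ ?_
  rintro _ ⟨n, f, rfl, rfl⟩
  rw [div_le_iff₀' hC]
  exact h n f

end QuasiNorm

/-! ### Norms in `ℓ₂` and coordinates -/

theorem sum_norm_sq_le (f : L2 𝕜) (s : Finset ℕ) : ∑ i ∈ s, ‖(f : ℕ → 𝕜) i‖ ^ 2 ≤ ‖f‖ ^ 2 := by
  have h := lp.sum_rpow_le_norm_rpow (p := 2) (by norm_num) f s
  simpa using h

theorem norm_le_of_sum_sq_le {f : L2 𝕜} {C : ℝ} (hC : 0 ≤ C)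
    (h : ∀ s : Finset ℕ, ∑ i ∈ s, ‖(f : ℕ → 𝕜) i‖ ^ 2 ≤ C ^ 2) : ‖f‖ ≤ C :=
  lp.norm_le_of_forall_sum_le (p := 2) (by norm_num) hC fun s => by simpa using h s

theorem norm_sq_incl (x : ℕ →₀ 𝕜) {s : Finset ℕ} (hs : x.support ⊆ s) :
    ‖incl 𝕜 x‖ ^ 2 = ∑ i ∈ s, ‖x i‖ ^ 2 := by
  refine le_antisymm ?_ (sum_norm_sq_le (incl 𝕜 x) s)
  have h0 : 0 ≤ ∑ i ∈ s, ‖x i‖ ^ 2 := Finset.sum_nonneg fun i _ => by positivity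
  rw [← Real.sqrt_le_sqrt_iff h0, Real.sqrt_sq (norm_nonneg _)]
  refine norm_le_of_sum_sq_le (Real.sqrt_nonneg _) fun t => ?_
  rw [Real.sq_sqrt h0]
  calc ∑ i ∈ t, ‖x i‖ ^ 2 ≤ ∑ i ∈ t ∪ s, ‖x i‖ ^ 2 :=
        Finset.sum_le_sum_of_subset_of_nonneg Finset.subset_union_left fun _ _ _ => by positivity
    _ = ∑ i ∈ s, ‖x i‖ ^ 2 := by
        refine (Finset.sum_subset Finset.subset_union_right fun i _ hi => ?_).symm
        have : x i = 0 := by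
          by_contra hx
          exact hi (hs (Finsupp.mem_support_iff.2 hx))
        simp [this]

theorem norm_coord_le (f : L2 𝕜) (i : ℕ) : ‖(f : ℕ → 𝕜) i‖ ≤ ‖f‖ :=
  lp.norm_apply_le_norm (by norm_num) f i

/-! ### `Ω_φ` is almost additive for sums of arbitrary length -/

theorem abs_log_le_add_inv {r : ℝ} (hr : 0 < r) : |Real.log r| ≤ r + r⁻¹ := by
  have h1 := Real.log_le_self hr.le
  have h2 := Real.log_le_self (inv_pos.2 hr).le
  rw [Real.log_inv] at h2
  have := inv_pos.2 hr
  exact abs_le.2 ⟨by linarith, by linarith⟩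

/-- The coordinate of the almost additivity of `Ω_φ`. -/
theorem coord_estimate_sum (φ : LipMap 𝕜) {K : ℝ≥0} (hK : LipschitzWith K (φ : ℝ≥0 → 𝕜))
    {ι : Type*} (s : Finset ι) (t : ι → 𝕜) (p : ι → ℝ) (hp : ∀ i ∈ s, 0 ≤ p i)
    (hpt : ∀ i ∈ s, ‖t i‖ ≤ p i) {P : ℝ} (hP : ∑ i ∈ s, p i = P) (hP0 : 0 < P) {w : ℝ}
    (hw : 0 ≤ w) (hw2 : w ^ 2 = P * ∑ i ∈ s, ‖t i‖ ^ 2 / p i) :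
    ‖(∑ i ∈ s, t i) * (φ : ℝ≥0 → 𝕜) (Real.toNNReal (-Real.log (‖∑ i ∈ s, t i‖ / P))) -
      ∑ i ∈ s, t i * (φ : ℝ≥0 → 𝕜) (Real.toNNReal (-Real.log (‖t i‖ / p i)))‖ ≤ 3 * K * w := by
  have hsum : ‖∑ i ∈ s, t i‖ ≤ w := by
    refine (norm_sum_le _ _).trans ?_
    refine abs_le_of_sq_le_sq' ?_ hw |>.2
    rw [hw2, ← hP]
    refine Finset.sum_sq_le_sum_mul_sum_of_sq_le_mul s hp
      (fun i hi => div_nonneg (by positivity) (hp i hi)) fun i hi => ?_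
    rcases (hp i hi).eq_or_lt with h | h
    · have : ‖t i‖ = 0 := le_antisymm (by rw [h]; exact hpt i hi) (norm_nonneg _)
      simp [this]
    · refine le_of_eq ?_
      field_simp
  have e1 := coord_estimate φ hK hP0 _ hsum
  set Q := (φ : ℝ≥0 → 𝕜) (Real.toNNReal (-Real.log (w / P)))
  -- All arguments of `φ` are compared with `-log (w / P)`. With `r = ‖t i‖ P / (p i w)` the bound
  -- `|log r| ≤ r + r⁻¹` gives two terms; by the choice of `w` each of them sums to `w`.
  have e2 : ∀ i ∈ s, ‖t i * (φ : ℝ≥0 → 𝕜) (Real.toNNReal (-Real.log (‖t i‖ / p i))) - t i * Q‖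
      ≤ K * (‖t i‖ ^ 2 / p i * P / w + p i * w / P) := by
    intro i hi
    rcases eq_or_ne (t i) 0 with h | h
    · have := hp i hi
      simp only [h, zero_mul, sub_zero, norm_zero]
      positivity
    have ht : 0 < ‖t i‖ := norm_pos_iff.2 h
    have hpi : 0 < p i := ht.trans_le (hpt i hi)
    have hw0 : 0 < w := by
      refine hw.lt_of_ne fun h0 => ?_
      rw [← h0] at hw2
      have h1 : ∑ i ∈ s, ‖t i‖ ^ 2 / p i = 0 := by
        have : P * ∑ i ∈ s, ‖t i‖ ^ 2 / p i = 0 := by rw [← hw2]; norm_num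
        exact (mul_eq_zero.1 this).resolve_left hP0.ne'
      have h2 := (Finset.sum_eq_zero_iff_of_nonneg
        fun j hj => div_nonneg (by positivity) (hp j hj)).1 h1 i hi
      have : 0 < ‖t i‖ ^ 2 / p i := by positivity
      linarith
    refine (lip_estimate φ hK _ _ _).trans ?_
    gcongr
    have h1 : -Real.log (‖t i‖ / p i) - -Real.log (w / P)
        = -Real.log (‖t i‖ * P / (p i * w)) := by
      rw [Real.log_div ht.ne' hpi.ne', Real.log_div hw0.ne' hP0.ne',
        Real.log_div (by positivity) (by positivity), Real.log_mul ht.ne' hP0.ne',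
        Real.log_mul hpi.ne' hw0.ne']
      ring
    rw [h1, abs_neg]
    calc ‖t i‖ * |Real.log (‖t i‖ * P / (p i * w))|
        ≤ ‖t i‖ * (‖t i‖ * P / (p i * w) + (‖t i‖ * P / (p i * w))⁻¹) := by
          gcongr
          exact abs_log_le_add_inv (by positivity)
      _ = _ := by field_simp
  have e3 : ‖∑ i ∈ s, (t i * (φ : ℝ≥0 → 𝕜) (Real.toNNReal (-Real.log (‖t i‖ / p i))) - t i * Q)‖
      ≤ K * (2 * w) := by
    refine (norm_sum_le _ _).trans ((Finset.sum_le_sum e2).trans ?_)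
    rw [← Finset.mul_sum]
    gcongr
    rw [Finset.sum_add_distrib]
    have h1 : ∑ i ∈ s, ‖t i‖ ^ 2 / p i * P / w = w ^ 2 / w := by
      rw [hw2, ← Finset.sum_div, ← Finset.sum_mul, mul_comm]
    have h2 : ∑ i ∈ s, p i * w / P = w := by
      rw [← Finset.sum_div, ← Finset.sum_mul, hP]
      field_simp
    rw [h1, h2, sq, mul_self_div_self]
    linarith
  rw [Finset.sum_sub_distrib, ← Finset.sum_mul] at e3
  have e : ∀ A B D : 𝕜, A - D = (A - B) - (D - B) := fun A B D => by ring
  rw [e _ ((∑ i ∈ s, t i) * Q) _]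
  refine (norm_sub_le _ _).trans ?_
  linarith

theorem incl_sum_le {n : ℕ} (x : Fin n → ℕ →₀ 𝕜) :
    ‖incl 𝕜 (∑ i, x i)‖ ≤ ∑ i, ‖incl 𝕜 (x i)‖ := by
  rw [map_sum]
  exact norm_sum_le _ _

theorem lp_sum_apply {ι : Type*} (s : Finset ι) (f : ι → L2 𝕜) (j : ℕ) :
    ((∑ i ∈ s, f i : L2 𝕜) : ℕ → 𝕜) j = ∑ i ∈ s, (f i : ℕ → 𝕜) j := by
  rw [lp.coeFn_sum, Finset.sum_apply]

/-- With `P = ∑ ‖x i‖`, the coordinate errors are at most `3 K w j`, where `w j ^ 2 = P ∑ |x i j|² /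
‖x i‖`. Summing over `j` first gives `‖w‖ ≤ P`. Replacing the norm of the sum by `P` costs the
fourth `K`. -/
theorem Omega_sum (φ : LipMap 𝕜) {K : ℝ≥0} (hK : LipschitzWith K (φ : ℝ≥0 → 𝕜)) {n : ℕ}
    (x : Fin n → ℕ →₀ 𝕜) :
    ‖Omega φ (∑ i, x i) - ∑ i, Omega φ (x i)‖ ≤ 4 * K * ∑ i, ‖incl 𝕜 (x i)‖ := by
  set P := ∑ i, ‖incl 𝕜 (x i)‖ with hP
  have hP0 : 0 ≤ P := by positivity
  rcases hP0.eq_or_lt with h0 | h0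
  · have : ∀ i, x i = 0 := fun i => incl_eq_zero
      ((Finset.sum_eq_zero_iff_of_nonneg fun _ _ => norm_nonneg _).1 h0.symm i (Finset.mem_univ i))
    simp only [this, Finset.sum_const_zero, Omega_zero, sub_zero, norm_zero]
    positivity
  have h1 := norm_Omega_sub_OmegaAt φ hK h0 (∑ i, x i) (incl_sum_le x)
  set T : Finset ℕ := Finset.univ.biUnion fun i => (x i).support
  set w : ℕ → ℝ := fun j => √(P * ∑ i, ‖x i j‖ ^ 2 / ‖incl 𝕜 (x i)‖) with hw
  have hw2 : ∀ j, w j ^ 2 = P * ∑ i, ‖x i j‖ ^ 2 / ‖incl 𝕜 (x i)‖ := fun j =>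
    Real.sq_sqrt (by positivity)
  have hsumT : ∀ i, ∑ j ∈ T, ‖x i j‖ ^ 2 = ‖incl 𝕜 (x i)‖ ^ 2 := fun i =>
    (norm_sq_incl (x i) (Finset.subset_biUnion_of_mem (fun i => (x i).support)
      (Finset.mem_univ i))).symm
  have hwT : ∀ t : Finset ℕ, ∑ j ∈ t, w j ^ 2 ≤ P ^ 2 := by
    intro t
    simp_rw [hw2]
    rw [← Finset.mul_sum, Finset.sum_comm, sq]
    gcongr
    refine Finset.sum_le_sum fun i _ => ?_
    rw [← Finset.sum_div]
    refine div_le_of_le_mul₀ (norm_nonneg _) (norm_nonneg _) ?_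
    rw [← sq]
    exact sum_norm_sq_le (incl 𝕜 (x i)) t
  have h2 : ‖OmegaAt φ P (∑ i, x i) - ∑ i, Omega φ (x i)‖ ≤ 3 * K * P := by
    refine norm_le_of_sum_sq_le (by positivity) fun t => ?_
    calc _ ≤ ∑ j ∈ t, (3 * K * w j) ^ 2 := by
          refine Finset.sum_le_sum fun j _ => ?_
          gcongr
          rw [lp.coeFn_sub, Pi.sub_apply, lp_sum_apply]
          change ‖(∑ i, x i) j * (φ : ℝ≥0 → 𝕜) (Real.toNNReal (-Real.log (‖(∑ i, x i) j‖ / P)))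
            - ∑ i, x i j * _‖ ≤ _
          rw [Finsupp.finsetSum_apply]
          exact coord_estimate_sum φ hK Finset.univ (fun i => x i j)
            (fun i => ‖incl 𝕜 (x i)‖) (fun _ _ => norm_nonneg _)
            (fun i _ => norm_coord_le (incl 𝕜 (x i)) j) hP.symm h0 (Real.sqrt_nonneg _) (hw2 j)
      _ = (3 * K) ^ 2 * ∑ j ∈ t, w j ^ 2 := by
          rw [Finset.mul_sum]
          exact Finset.sum_congr rfl fun j _ => by ring
      _ ≤ (3 * K) ^ 2 * P ^ 2 := by gcongr; exact hwT t
      _ = _ := by ring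
  calc _ ≤ ‖Omega φ (∑ i, x i) - OmegaAt φ P (∑ i, x i)‖
        + ‖OmegaAt φ P (∑ i, x i) - ∑ i, Omega φ (x i)‖ := norm_sub_le_norm_sub_add_norm_sub _ _ _
    _ ≤ K * P + 3 * K * P := add_le_add h1 h2
    _ = _ := by ring

theorem quasiNorm_mk (φ : LipMap 𝕜) (y : L2 𝕜) (x : ℕ →₀ 𝕜) :
    (quasiNorm φ).toFun (PreZ.mk φ y x) = ‖y - Omega φ x‖ + ‖incl 𝕜 x‖ := rfl

/-- The projections of `ℓ₂ × c₀₀`, as linear maps. -/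
def PreZ.fst (φ : LipMap 𝕜) : PreZ φ →ₗ[𝕜] L2 𝕜 := LinearMap.fst 𝕜 (L2 𝕜) (ℕ →₀ 𝕜)

/-- The second projection of `ℓ₂ × c₀₀`. -/
def PreZ.snd (φ : LipMap 𝕜) : PreZ φ →ₗ[𝕜] (ℕ →₀ 𝕜) := LinearMap.snd 𝕜 (L2 𝕜) (ℕ →₀ 𝕜)

theorem quasiNorm_apply (φ : LipMap 𝕜) (z : PreZ φ) : (quasiNorm φ).toFun z =
    ‖PreZ.fst φ z - Omega φ (PreZ.snd φ z)‖ + ‖incl 𝕜 (PreZ.snd φ z)‖ := rfl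

theorem quasiNorm_sum_le (φ : LipMap 𝕜) : ∃ C : ℝ, 0 < C ∧ ∀ (n : ℕ) (f : Fin n → PreZ φ),
    (quasiNorm φ).toFun (∑ i, f i) ≤ C * ∑ i, (quasiNorm φ).toFun (f i) := by
  obtain ⟨-, K, hK⟩ := φ.2
  refine ⟨4 * K + 1, by positivity, fun n f => ?_⟩
  simp only [quasiNorm_apply, map_sum (PreZ.fst φ), map_sum (PreZ.snd φ)]
  have h1 := Omega_sum φ hK fun i => PreZ.snd φ (f i)
  have h2 := incl_sum_le fun i => PreZ.snd φ (f i)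
  have e : ∑ i, PreZ.fst φ (f i) - Omega φ (∑ i, PreZ.snd φ (f i)) =
      ∑ i, (PreZ.fst φ (f i) - Omega φ (PreZ.snd φ (f i)))
        - (Omega φ (∑ i, PreZ.snd φ (f i)) - ∑ i, Omega φ (PreZ.snd φ (f i))) := by
    rw [Finset.sum_sub_distrib]
    abel
  rw [e]
  have h3 := norm_sub_le (∑ i, (PreZ.fst φ (f i) - Omega φ (PreZ.snd φ (f i))))
    (Omega φ (∑ i, PreZ.snd φ (f i)) - ∑ i, Omega φ (PreZ.snd φ (f i)))
  have h4 := norm_sum_le Finset.univ fun i => PreZ.fst φ (f i) - Omega φ (PreZ.snd φ (f i))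
  rw [Finset.sum_add_distrib]
  set a := ∑ i, ‖PreZ.fst φ (f i) - Omega φ (PreZ.snd φ (f i))‖
  set b := ∑ i, ‖incl 𝕜 (PreZ.snd φ (f i))‖
  have ha : 0 ≤ a := by positivity
  have hb : 0 ≤ b := by positivity
  have hKa : 0 ≤ (K : ℝ) * a := by positivity
  linarith

/-! ### `Z(φ)` as a Banach space -/

instance (φ : LipMap 𝕜) : Norm (PreZ φ) := ⟨(quasiNorm φ).envelope⟩

theorem norm_le_quasiNorm (φ : LipMap 𝕜) (z : PreZ φ) : ‖z‖ ≤ (quasiNorm φ).toFun z :=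
  (quasiNorm φ).envelope_le z

theorem quasiNorm_le_norm (φ : LipMap 𝕜) :
    ∃ C : ℝ, 0 < C ∧ ∀ z : PreZ φ, (quasiNorm φ).toFun z ≤ C * ‖z‖ := by
  obtain ⟨C, hC, h⟩ := quasiNorm_sum_le φ
  exact ⟨C, hC, (quasiNorm φ).le_envelope hC h⟩

theorem preZ_core (φ : LipMap 𝕜) : NormedSpace.Core 𝕜 (PreZ φ) where
  norm_nonneg := (quasiNorm φ).envelope_nonneg
  norm_smul := (quasiNorm φ).envelope_smul
  norm_triangle := (quasiNorm φ).envelope_add_le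
  norm_eq_zero_iff z := by
    obtain ⟨C, hC, h⟩ := quasiNorm_le_norm φ
    refine ⟨fun h0 => ?_, ?_⟩
    · have := h z
      rw [h0, mul_zero] at this
      exact ((quasiNorm φ).eq_zero_iff' z).1 (le_antisymm this ((quasiNorm φ).nonneg' z))
    · rintro rfl
      refine le_antisymm ((norm_le_quasiNorm φ 0).trans_eq (quasiNorm φ).map_zero)
        ((quasiNorm φ).envelope_nonneg _)

/-- The uniformity is kept equal to that of the quasi-norm, so that `Z φ`, which was defined from
it, is the completion of this normed space and hence itself a Banach space. -/
instance (φ : LipMap 𝕜) : NormedAddCommGroup (PreZ φ) :=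
  NormedAddCommGroup.ofCoreReplaceUniformity (preZ_core φ) (by
    obtain ⟨C, hC, h⟩ := quasiNorm_le_norm φ
    let M := PseudoMetricSpace.ofSeminormedSpaceCore (preZ_core φ).toCore
    have hd : ∀ a b : PreZ φ, @dist _ M.toDist a b = ‖a - b‖ := fun a b => by
      change ‖-a + b‖ = _
      rw [← neg_sub a b |>.trans (by abel : b - a = -a + b), ← neg_one_smul 𝕜,
        (preZ_core φ).norm_smul]
      simp
    refine (quasiNorm φ).hasBasis_uniformity.ext (@Metric.uniformity_basis_dist _ M) ?_ ?_
    · intro ε hε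
      refine ⟨ε / C, by positivity, fun p hp => ?_⟩
      have hp : @dist _ M.toDist p.1 p.2 < ε / C := hp
      rw [hd, lt_div_iff₀' hC] at hp
      exact (h _).trans_lt hp
    · intro ε hε
      refine ⟨ε, hε, fun p hp => ?_⟩
      have hp : (quasiNorm φ).toFun (p.1 - p.2) < ε := hp
      change @dist _ M.toDist p.1 p.2 < ε
      rw [hd]
      exact (norm_le_quasiNorm φ _).trans_lt hp)

instance (φ : LipMap 𝕜) : NormedSpace 𝕜 (PreZ φ) := NormedSpace.ofCore (preZ_core φ)

theorem isBanachable_Z.{u} {𝕜 : Type u} [RCLike 𝕜] (φ : LipMap 𝕜) : IsBanachable 𝕜 (Z φ) :=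
  ⟨Z φ, inferInstance, inferInstance, inferInstance, ⟨ContinuousLinearEquiv.refl 𝕜 (Z φ)⟩⟩

/-! ### The exact sequence `0 → ℓ₂ → Z(φ) → ℓ₂ → 0` -/

theorem norm_toZ (φ : LipMap 𝕜) (z : PreZ φ) : ‖toZ φ z‖ = ‖z‖ :=
  UniformSpace.Completion.norm_coe z

theorem exists_toZ_norm_sub_lt (φ : LipMap 𝕜) (w : Z φ) {ε : ℝ} (hε : 0 < ε) :
    ∃ z : PreZ φ, ‖w - toZ φ z‖ < ε := by
  obtain ⟨z, hz⟩ := (UniformSpace.Completion.denseRange_coe (α := PreZ φ)).exists_dist_lt w hε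
  exact ⟨z, by rwa [dist_eq_norm] at hz⟩

theorem iMap_apply (φ : LipMap 𝕜) (y : L2 𝕜) : iMap φ y = toZ φ (PreZ.mk φ y 0) := rfl

theorem qMap_toZ_mk (φ : LipMap 𝕜) (y : L2 𝕜) (x : ℕ →₀ 𝕜) :
    qMap φ (toZ φ (PreZ.mk φ y x)) = incl 𝕜 x := qMap_toZ φ _

theorem norm_Omega_mk_le (φ : LipMap 𝕜) (x : ℕ →₀ 𝕜) :
    ‖toZ φ (PreZ.mk φ (Omega φ x) x)‖ ≤ ‖incl 𝕜 x‖ := by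
  rw [norm_toZ]
  refine (norm_le_quasiNorm φ _).trans_eq ?_
  simp [quasiNorm_mk]

theorem mk_sub_Omega (φ : LipMap 𝕜) (y : L2 𝕜) (x : ℕ →₀ 𝕜) :
    PreZ.mk φ y x - PreZ.mk φ (y - Omega φ x) 0 = PreZ.mk φ (Omega φ x) x :=
  Prod.ext (sub_sub_cancel y _) (sub_zero x)

theorem exists_norm_le_iMap (φ : LipMap 𝕜) : ∃ C : ℝ≥0, ∀ y : L2 𝕜, ‖y‖ ≤ C * ‖iMap φ y‖ := by
  obtain ⟨C, hC, h⟩ := quasiNorm_le_norm φ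
  lift C to ℝ≥0 using hC.le
  refine ⟨C, fun y => ?_⟩
  rw [iMap_apply, norm_toZ]
  have := h (PreZ.mk φ y 0)
  simpa [quasiNorm_mk] using this

theorem isClosedEmbedding_iMap (φ : LipMap 𝕜) : Topology.IsClosedEmbedding (iMap φ) := by
  obtain ⟨C, hC⟩ := exists_norm_le_iMap φ
  exact ((iMap φ).antilipschitz_of_bound hC).isClosedEmbedding (iMap φ).uniformContinuous

theorem qMap_iMap (φ : LipMap 𝕜) (y : L2 𝕜) : qMap φ (iMap φ y) = 0 := by
  rw [iMap_apply, qMap_toZ_mk, map_zero]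

/-- The distance of `w` to the range of `i` is at most `‖q w‖`. -/
theorem exists_norm_sub_iMap_lt (φ : LipMap 𝕜) (w : Z φ) {ε : ℝ} (hε : 0 < ε) :
    ∃ y : L2 𝕜, ‖w - iMap φ y‖ < ‖qMap φ w‖ + ε := by
  have hpos : 0 < 1 + ‖qMap φ‖ := by positivity
  obtain ⟨⟨y, x⟩, hz⟩ := exists_toZ_norm_sub_lt φ w (ε := ε / (1 + ‖qMap φ‖)) (by positivity)
  change ‖w - toZ φ (PreZ.mk φ y x)‖ < _ at hz
  -- The difference `(y, x) - (y - Ω x, 0)` is `(Ω x, x)`, whose norm is at most `‖x‖`.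
  refine ⟨y - Omega φ x, ?_⟩
  have h1 : ‖incl 𝕜 x‖ ≤ ‖qMap φ w‖ + ‖qMap φ‖ * ‖w - toZ φ (PreZ.mk φ y x)‖ := by
    have := norm_sub_le (qMap φ w) (qMap φ (w - toZ φ (PreZ.mk φ y x)))
    have e : qMap φ w - qMap φ (w - toZ φ (PreZ.mk φ y x)) = incl 𝕜 x := by
      rw [map_sub, sub_sub_cancel, qMap_toZ_mk]
    rw [e] at this
    exact this.trans (by gcongr; exact (qMap φ).le_opNorm _)
  have h2 : w - iMap φ (y - Omega φ x) = (w - toZ φ (PreZ.mk φ y x)) +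
      toZ φ (PreZ.mk φ (Omega φ x) x) := by
    rw [← mk_sub_Omega φ y x, map_sub (toZ φ), iMap_apply, sub_add_sub_cancel]
  rw [h2]
  refine (norm_add_le _ _).trans_lt ?_
  have h3 := norm_Omega_mk_le φ x
  rw [lt_div_iff₀ hpos] at hz
  linarith

theorem range_iMap (φ : LipMap 𝕜) : Set.range (iMap φ) = {w | qMap φ w = 0} := by
  ext w
  constructor
  · rintro ⟨y, rfl⟩
    exact qMap_iMap φ y
  · intro hw
    have hw : qMap φ w = 0 := hw
    rw [← (isClosedEmbedding_iMap φ).isClosed_range.closure_eq, Metric.mem_closure_iff]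
    intro ε hε
    obtain ⟨y, hy⟩ := exists_norm_sub_iMap_lt φ w hε
    rw [hw, norm_zero, zero_add] at hy
    exact ⟨_, ⟨y, rfl⟩, by rwa [dist_eq_norm]⟩

theorem dense_range_incl : Dense (Set.range (incl 𝕜)) := by
  intro f
  have h := lp.hasSum_single (p := 2) (by norm_num) f
  refine mem_closure_of_tendsto h (Filter.Eventually.of_forall fun s => ?_)
  refine ⟨∑ i ∈ s, Finsupp.single i ((f : ℕ → 𝕜) i), ?_⟩
  rw [map_sum]
  refine Finset.sum_congr rfl fun i _ => ?_
  ext n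
  rw [incl_apply, lp.single_apply, Finsupp.single_apply, Pi.single_apply]
  by_cases hn : i = n
  · subst hn; simp
  · simp [hn, Ne.symm hn]

/-- The vectors `(Ω x, x)` lift the dense subspace `c₀₀` without increasing norms; completeness of
`Z φ` extends controlled lifting to the closure. -/
theorem qMap_surjective (φ : LipMap 𝕜) : Function.Surjective (qMap φ) := by
  let f : NormedAddGroupHom (Z φ) (L2 𝕜) :=
    (qMap φ).toLinearMap.toAddMonoidHom.mkNormedAddGroupHom ‖qMap φ‖ (qMap φ).le_opNorm
  have hf : f.SurjectiveOnWith (incl 𝕜).toAddMonoidHom.range 1 := by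
    rintro _ ⟨x, rfl⟩
    refine ⟨toZ φ (PreZ.mk φ (Omega φ x) x), qMap_toZ_mk φ _ x, ?_⟩
    rw [one_mul]
    exact norm_Omega_mk_le φ x
  have h := controlled_closure_of_complete one_pos one_pos hf
  intro y
  obtain ⟨w, hw, -⟩ := h y (by
    change y ∈ closure (Set.range (incl 𝕜))
    exact dense_range_incl y)
  exact ⟨w, hw⟩

theorem isTwistedHilbert_Z.{u} {𝕜 : Type u} [RCLike 𝕜] (φ : LipMap 𝕜) :
    IsTwistedHilbert (iMap φ) (qMap φ) where
  isBanachable := isBanachable_Z φ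
  isEmbedding := (isClosedEmbedding_iMap φ).isEmbedding
  exact := range_iMap φ
  surjective := qMap_surjective φ
  isOpenMap := (qMap φ).isOpenMap (qMap_surjective φ)

/-! ### Almost disjoint vectors -/

/-- Apply `log v ≤ v - 1` to `v = √u` and square. -/
theorem sq_log_le {u : ℝ} (hu : 1 ≤ u) : Real.log u ^ 2 ≤ 4 * (u - 1) := by
  have hu0 : 0 ≤ u := by linarith
  have h1 : 1 ≤ √u := Real.one_le_sqrt.2 hu
  have h2 : Real.log √u ≤ √u - 1 := Real.log_le_sub_one_of_pos (by linarith)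
  rw [Real.log_sqrt hu0] at h2
  have h3 := Real.log_nonneg hu
  have h4 := Real.sq_sqrt hu0
  nlinarith

/-- Unlike the bound `K * m` of `coord_estimate`, this one vanishes at `‖t‖ = m`. It therefore makes
the additivity error at a coordinate small as soon as one of the two summands is small there. -/
theorem coord_estimate_sqrt (φ : LipMap 𝕜) {K : ℝ≥0} (hK : LipschitzWith K (φ : ℝ≥0 → 𝕜))
    {s m : ℝ} (hs : 0 < s) (t : 𝕜) (htm : ‖t‖ ≤ m) :
    ‖t * (φ : ℝ≥0 → 𝕜) (Real.toNNReal (-Real.log (‖t‖ / s))) -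
      t * (φ : ℝ≥0 → 𝕜) (Real.toNNReal (-Real.log (m / s)))‖ ≤ 2 * K * √(‖t‖ * (m - ‖t‖)) := by
  rcases eq_or_ne t 0 with rfl | ht
  · simp
  have ht' : 0 < ‖t‖ := norm_pos_iff.2 ht
  have hm : 0 < m := ht'.trans_le htm
  refine (lip_estimate φ hK t _ _).trans ?_
  have h1 : -Real.log (‖t‖ / s) - -Real.log (m / s) = Real.log (m / ‖t‖) := by
    rw [Real.log_div ht'.ne' hs.ne', Real.log_div hm.ne' hs.ne', Real.log_div hm.ne' ht'.ne']
    ring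
  rw [h1, mul_comm (2 : ℝ), mul_assoc]
  refine mul_le_mul_of_nonneg_left ?_ K.2
  have h2 := sq_log_le ((one_le_div ht').2 htm)
  rw [← abs_of_nonneg (by positivity : 0 ≤ ‖t‖ * |Real.log (m / ‖t‖)|)]
  refine abs_le_of_sq_le_sq ?_ (by positivity)
  rw [mul_pow, mul_pow, sq_abs, Real.sq_sqrt (mul_nonneg ht'.le (sub_nonneg.2 htm))]
  calc ‖t‖ ^ 2 * Real.log (m / ‖t‖) ^ 2 ≤ ‖t‖ ^ 2 * (4 * (m / ‖t‖ - 1)) := by gcongr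
    _ = _ := by field_simp; ring

/-- The first factor is at most twice the larger of the two norms, the second at most twice the
smaller. -/
theorem norm_add_mul_sub_le (a b : 𝕜) :
    ‖a + b‖ * (‖a‖ + ‖b‖ - ‖a + b‖) ≤ 4 * (‖a‖ * ‖b‖) := by
  have h1 := norm_add_le a b
  have h2 := norm_sub_le (a + b) b
  have h3 := norm_sub_le (a + b) a
  rw [add_sub_cancel_right] at h2
  rw [add_sub_cancel_left] at h3
  have ha := norm_nonneg a
  have hb := norm_nonneg b
  rcases le_total ‖a‖ ‖b‖ with h | h
  · calc _ ≤ (2 * ‖b‖) * (2 * ‖a‖) :=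
          mul_le_mul (by linarith) (by linarith) (by linarith) (by linarith)
      _ = _ := by ring
  · calc _ ≤ (2 * ‖a‖) * (2 * ‖b‖) :=
          mul_le_mul (by linarith) (by linarith) (by linarith) (by linarith)
      _ = _ := by ring

theorem coord_estimate_add (φ : LipMap 𝕜) {K : ℝ≥0} (hK : LipschitzWith K (φ : ℝ≥0 → 𝕜))
    {s : ℝ} (hs : 0 < s) (x y : ℕ →₀ 𝕜) (n : ℕ) :
    ‖(OmegaAt φ s (x + y) - OmegaAt φ s x - OmegaAt φ s y : L2 𝕜) n‖
      ≤ 8 * K * √(‖x n‖ * ‖y n‖) := by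
  set m := ‖x n‖ + ‖y n‖ with hm
  have e1 := coord_estimate_sqrt φ hK hs (x n) (m := m) (by simp [m])
  have e2 := coord_estimate_sqrt φ hK hs (y n) (m := m) (by simp [m])
  have e3 := coord_estimate_sqrt φ hK hs (x n + y n) (m := m) (norm_add_le _ _)
  have e4 : √(‖x n + y n‖ * (m - ‖x n + y n‖)) ≤ 2 * √(‖x n‖ * ‖y n‖) := by
    rw [show (2 : ℝ) = √4 by rw [show (4 : ℝ) = 2 ^ 2 by norm_num]; simp,
      ← Real.sqrt_mul (by norm_num)]
    exact Real.sqrt_le_sqrt (norm_add_mul_sub_le _ _)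
  rw [hm, add_sub_cancel_left, ← hm] at e1
  rw [hm, add_sub_cancel_right, ← hm, mul_comm ‖y n‖] at e2
  set P := (φ : ℝ≥0 → 𝕜) (Real.toNNReal (-Real.log (m / s)))
  set A := x n * (φ : ℝ≥0 → 𝕜) (Real.toNNReal (-Real.log (‖x n‖ / s)))
  set B := y n * (φ : ℝ≥0 → 𝕜) (Real.toNNReal (-Real.log (‖y n‖ / s)))
  set D := (x n + y n) * (φ : ℝ≥0 → 𝕜) (Real.toNNReal (-Real.log (‖x n + y n‖ / s)))
  change ‖D - A - B‖ ≤ _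
  have e : D - A - B = (D - (x n + y n) * P) - (A - x n * P) - (B - y n * P) := by ring
  rw [e]
  have n1 := norm_sub_le (D - (x n + y n) * P - (A - x n * P)) (B - y n * P)
  have n2 := norm_sub_le (D - (x n + y n) * P) (A - x n * P)
  have e5 := mul_le_mul_of_nonneg_left e4 (by positivity : 0 ≤ 2 * (K : ℝ))
  linarith

theorem norm_OmegaAt_add (φ : LipMap 𝕜) {K : ℝ≥0} (hK : LipschitzWith K (φ : ℝ≥0 → 𝕜))
    {s : ℝ} (hs : 0 < s) (x y : ℕ →₀ 𝕜) {T : Finset ℕ} (hT : x.support ⊆ T) :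
    ‖OmegaAt φ s (x + y) - OmegaAt φ s x - OmegaAt φ s y‖
      ≤ 8 * K * √(∑ j ∈ T, ‖x j‖ * ‖y j‖) := by
  refine norm_le_of_sum_sq_le (by positivity) fun t => ?_
  have h : ∀ j, ‖(OmegaAt φ s (x + y) - OmegaAt φ s x - OmegaAt φ s y : L2 𝕜) j‖ ^ 2
      ≤ (8 * K) ^ 2 * (‖x j‖ * ‖y j‖) := fun j => by
    calc _ ≤ (8 * K * √(‖x j‖ * ‖y j‖)) ^ 2 := by
          gcongr
          exact coord_estimate_add φ hK hs x y j
      _ = _ := by rw [mul_pow, Real.sq_sqrt (by positivity)]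
  refine (Finset.sum_le_sum fun j _ => h j).trans ?_
  rw [← Finset.mul_sum, mul_pow _ √_, Real.sq_sqrt (Finset.sum_nonneg fun j _ => by positivity)]
  refine mul_le_mul_of_nonneg_left ?_ (by positivity)
  calc ∑ j ∈ t, ‖x j‖ * ‖y j‖ ≤ ∑ j ∈ t ∪ T, ‖x j‖ * ‖y j‖ :=
        Finset.sum_le_sum_of_subset_of_nonneg Finset.subset_union_left fun _ _ _ => by positivity
    _ = _ := by
        refine (Finset.sum_subset Finset.subset_union_right fun i _ hi => ?_).symm
        have : x i = 0 := by
          by_contra hx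
          exact hi (hT (Finsupp.mem_support_iff.2 hx))
        simp [this]

theorem OmegaAt_smul (φ : LipMap 𝕜) (s : ℝ) {c : 𝕜} (hc : ‖c‖ = 1) (x : ℕ →₀ 𝕜) :
    OmegaAt φ s (c • x) = c • OmegaAt φ s x := by
  ext n
  change (c * x n) * _ = c * (x n * _)
  rw [mul_assoc]
  simp [hc]

theorem OmegaAt_zero (φ : LipMap 𝕜) (s : ℝ) : OmegaAt φ s 0 = 0 := by
  ext n
  simp [OmegaAt]

theorem Omega_eq_OmegaAt (φ : LipMap 𝕜) (x : ℕ →₀ 𝕜) : Omega φ x = OmegaAt φ ‖incl 𝕜 x‖ x := rfl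

theorem norm_OmegaAt_sub_OmegaAt (φ : LipMap 𝕜) {K : ℝ≥0}
    (hK : LipschitzWith K (φ : ℝ≥0 → 𝕜)) {r s : ℝ} (hr : 0 < r) (hs : 0 < s) (x : ℕ →₀ 𝕜) :
    ‖OmegaAt φ r x - OmegaAt φ s x‖ ≤ K * |Real.log (r / s)| * ‖incl 𝕜 x‖ := by
  refine norm_le_of_coord (by positivity) fun n => ?_
  change ‖x n * _ - x n * _‖ ≤ _ * ‖x n‖
  rcases eq_or_ne (x n) 0 with h | h
  · simp [h]
  refine (lip_estimate φ hK _ _ _).trans_eq ?_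
  have hx := norm_ne_zero_iff.2 h
  have : -Real.log (‖x n‖ / r) - -Real.log (‖x n‖ / s) = Real.log (r / s) := by
    rw [Real.log_div hx hr.ne', Real.log_div hx hs.ne', Real.log_div hr.ne' hs.ne']
    ring
  rw [this]
  ring

/-- With `t = ‖x‖ / s` the error is `K |log t| t s`, and `|log t| ≤ t + t⁻¹`; the factor `t` absorbs
the singularity at small `x`. -/
theorem norm_Omega_sub_OmegaAt_of_le (φ : LipMap 𝕜) {K : ℝ≥0}
    (hK : LipschitzWith K (φ : ℝ≥0 → 𝕜)) {C s : ℝ} (hs : 0 < s) (x : ℕ →₀ 𝕜)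
    (hx : ‖incl 𝕜 x‖ ≤ C * s) : ‖Omega φ x - OmegaAt φ s x‖ ≤ K * (1 + C ^ 2) * s := by
  rcases (norm_nonneg (incl 𝕜 x)).eq_or_lt with h0 | h0
  · obtain rfl := incl_eq_zero h0.symm
    rw [Omega_zero, OmegaAt_zero, sub_zero, norm_zero]
    positivity
  rw [Omega_eq_OmegaAt]
  refine (norm_OmegaAt_sub_OmegaAt φ hK h0 hs x).trans ?_
  set t := ‖incl 𝕜 x‖ / s with ht
  have ht0 : 0 < t := by positivity
  have hxt : ‖incl 𝕜 x‖ = t * s := by rw [ht]; field_simp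
  have htC : t ≤ C := (div_le_iff₀ hs).2 hx
  rw [hxt]
  calc K * |Real.log t| * (t * s) ≤ K * (t + t⁻¹) * (t * s) := by
        gcongr
        exact abs_log_le_add_inv ht0
    _ = K * (1 + t ^ 2) * s := by field_simp; ring
    _ ≤ _ := by gcongr

/-- A gliding hump: the vectors already chosen live on a finite set `T`, on which later `x k` are
uniformly small, so each new vector adds an arbitrarily small error. The bound involves only
absolute values, hence is uniform in the unimodular coefficients. -/
theorem exists_almost_additive (φ : LipMap 𝕜) {s : ℝ} (hs : 0 < s) {x : ℕ → ℕ →₀ 𝕜}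
    (hx : ∀ j, Filter.Tendsto (fun k => x k j) Filter.atTop (𝓝 0)) {A : Set ℕ} (hA : A.Infinite)
    (n : ℕ) {η : ℝ} (hη : 0 < η) :
    ∃ G : Finset ℕ, ↑G ⊆ A ∧ G.card = n ∧ ∀ ε : ℕ → 𝕜, (∀ k, ‖ε k‖ = 1) →
      ‖OmegaAt φ s (∑ k ∈ G, ε k • x k) - ∑ k ∈ G, ε k • OmegaAt φ s (x k)‖ ≤ η := by
  obtain ⟨-, K, hK⟩ := φ.2
  induction n generalizing η with
  | zero => exact ⟨∅, by simp, rfl, fun ε _ => by simpa [OmegaAt_zero] using hη.le⟩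
  | succ n ih =>
    obtain ⟨G, hGA, hGn, hG⟩ := ih (half_pos hη)
    set T : Finset ℕ := G.biUnion fun l => (x l).support
    have hlim : Filter.Tendsto
        (fun k => 8 * (K : ℝ) * √(∑ j ∈ T, (∑ l ∈ G, ‖x l j‖) * ‖x k j‖)) Filter.atTop (𝓝 0) := by
      have h1 : Filter.Tendsto (fun k => ∑ j ∈ T, (∑ l ∈ G, ‖x l j‖) * ‖x k j‖) Filter.atTop
          (𝓝 (∑ j ∈ T, (∑ l ∈ G, ‖x l j‖) * ‖(0 : 𝕜)‖)) :=
        tendsto_finsetSum _ fun j _ => ((hx j).norm).const_mul _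
      have h2 := (h1.sqrt).const_mul (8 * (K : ℝ))
      simpa using h2
    have hev := (hlim.eventually_le_const (half_pos hη)).and
      (Filter.eventually_gt_atTop (G.sup id))
    obtain ⟨k, hkA, hk, hkG⟩ := ((Nat.frequently_atTop_iff_infinite.2 hA).and_eventually hev).exists
    have hkn : k ∉ G := fun h => (Finset.le_sup (f := id) h).not_gt hkG
    refine ⟨insert k G, ?_, by rw [Finset.card_insert_of_notMem hkn, hGn], fun ε hε => ?_⟩
    · rw [Finset.coe_insert]
      exact Set.insert_subset hkA hGA
    rw [Finset.sum_insert hkn, Finset.sum_insert hkn, add_comm (ε k • x k)]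
    set u := ∑ k ∈ G, ε k • x k with hu
    have huT : u.support ⊆ T := by
      intro j hj
      rw [Finsupp.mem_support_iff, hu, Finsupp.finsetSum_apply] at hj
      obtain ⟨l, hl, hlj⟩ := Finset.exists_ne_zero_of_sum_ne_zero hj
      refine Finset.mem_biUnion.2 ⟨l, hl, Finsupp.mem_support_iff.2 fun h => hlj ?_⟩
      simp [h]
    have h1 := norm_OmegaAt_add φ hK hs u (ε k • x k) huT
    have h2 : 8 * (K : ℝ) * √(∑ j ∈ T, ‖u j‖ * ‖(ε k • x k) j‖) ≤ η / 2 := by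
      refine le_trans ?_ hk
      gcongr with j _
      · rw [hu, Finsupp.finsetSum_apply]
        refine (norm_sum_le _ _).trans_eq (Finset.sum_congr rfl fun l _ => ?_)
        simp [hε]
      · simp [hε]
    rw [OmegaAt_smul φ s (hε k)] at h1
    have h3 := hG ε hε
    have e : OmegaAt φ s (u + ε k • x k) -
        (ε k • OmegaAt φ s (x k) + ∑ k ∈ G, ε k • OmegaAt φ s (x k)) =
        (OmegaAt φ s (u + ε k • x k) - OmegaAt φ s u - ε k • OmegaAt φ s (x k)) +
        (OmegaAt φ s u - ∑ k ∈ G, ε k • OmegaAt φ s (x k)) := by abel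
    rw [e]
    refine (norm_add_le _ _).trans ?_
    linarith

/-! ### Unimodular coefficients -/

/-- Signs are chosen one at a time, each making the real part of the inner product with the partial
sum nonnegative. -/
theorem exists_sum_sq_le {E : Type*} [NormedAddCommGroup E] [InnerProductSpace 𝕜 E]
    (G : Finset ℕ) (u : ℕ → E) :
    ∃ ε : ℕ → 𝕜, (∀ k, ‖ε k‖ = 1) ∧ ∑ k ∈ G, ‖u k‖ ^ 2 ≤ ‖∑ k ∈ G, ε k • u k‖ ^ 2 := by
  classical
  induction G using Finset.induction_on with
  | empty => exact ⟨fun _ => 1, by simp, by simp⟩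
  | insert k G hk ih =>
    obtain ⟨ε, hε, h⟩ := ih
    set v := ∑ k ∈ G, ε k • u k
    obtain ⟨c, hc, hcv⟩ : ∃ c : 𝕜, ‖c‖ = 1 ∧ ‖u k‖ ^ 2 + ‖v‖ ^ 2 ≤ ‖c • u k + v‖ ^ 2 := by
      rcases le_total 0 (RCLike.re (inner 𝕜 (u k) v)) with hi | hi
      · refine ⟨1, by simp, ?_⟩
        rw [one_smul, @norm_add_sq 𝕜]
        linarith
      · refine ⟨-1, by simp, ?_⟩
        rw [neg_one_smul, @norm_add_sq 𝕜, norm_neg, inner_neg_left, map_neg]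
        linarith
    refine ⟨Function.update ε k c, fun l => ?_, ?_⟩
    · by_cases hl : l = k
      · subst hl; simpa using hc
      · simpa [hl] using hε l
    · rw [Finset.sum_insert hk, Finset.sum_insert hk, Function.update_self]
      have : ∑ l ∈ G, Function.update ε k c l • u l = v := Finset.sum_congr rfl fun l hl => by
        rw [Function.update_of_ne (ne_of_mem_of_not_mem hl hk)]
      rw [this]
      linarith

/-- If `δ ≤ ‖a k‖` infinitely often, aligning the phases of `N` such terms gives `N δ ≤ C √N`, which
fails for large `N`. -/
theorem tendsto_zero_of_unimodular_sums {C : ℝ} {a : ℕ → 𝕜}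
    (h : ∀ N : ℕ, 1 ≤ N → ∃ k₀, ∀ G : Finset ℕ, (∀ k ∈ G, k₀ ≤ k) → G.card = N →
      ∀ ε : ℕ → 𝕜, (∀ k, ‖ε k‖ = 1) → ‖∑ k ∈ G, ε k • a k‖ ≤ C * √N) :
    Filter.Tendsto a Filter.atTop (𝓝 0) := by
  rw [Metric.tendsto_atTop']
  by_contra! hcon
  obtain ⟨δ, hδ, hcon⟩ := hcon
  obtain ⟨N, hN⟩ := exists_nat_gt (max ((C / δ) ^ 2) 1)
  have hN1 : (1 : ℝ) < N := (le_max_right _ _).trans_lt hN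
  obtain ⟨k₀, hk₀⟩ := h N (by exact_mod_cast hN1.le)
  have hinf : {k | k₀ ≤ k ∧ δ ≤ ‖a k‖}.Infinite := by
    refine Set.infinite_of_not_bddAbove fun ⟨M, hM⟩ => ?_
    obtain ⟨k, hk, hkδ⟩ := hcon (max M k₀)
    have := hM (show k ∈ {k | k₀ ≤ k ∧ δ ≤ ‖a k‖} from
      ⟨(le_max_right _ _).trans hk.le, by simpa using hkδ⟩)
    have := le_max_left M k₀
    omega
  obtain ⟨G, hG, hGN⟩ := hinf.exists_subset_card_eq N
  choose ε hε hεa using fun k => RCLike.exists_norm_eq_mul_self (a k)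
  have h1 := hk₀ G (fun k hk => (hG hk).1) hGN ε hε
  have h2 : ∑ k ∈ G, ε k • a k = ((∑ k ∈ G, ‖a k‖ : ℝ) : 𝕜) := by
    rw [RCLike.ofReal_sum]
    exact Finset.sum_congr rfl fun k _ => (hεa k).symm
  rw [h2, RCLike.norm_ofReal, abs_of_nonneg (by positivity)] at h1
  have h3 : (N : ℝ) * δ ≤ ∑ k ∈ G, ‖a k‖ := by
    have := Finset.card_nsmul_le_sum G (fun k => ‖a k‖) δ fun k hk => (hG hk).2
    rwa [hGN, nsmul_eq_mul] at this
  have hs : 0 < √(N : ℝ) := Real.sqrt_pos.2 (by linarith)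
  have h4 : C / δ < √N := Real.lt_sqrt_of_sq_lt ((le_max_left _ _).trans_lt hN)
  rw [div_lt_iff₀ hδ] at h4
  have h5 : (N : ℝ) = √N * √N := (Real.mul_self_sqrt (by linarith)).symm
  nlinarith

/-! ### Sequences with flat upper `2`-estimates -/

/-- For every `N`, the sums of any `N` vectors far out in the sequence `k ↦ (y N k, x k)`, with
unimodular coefficients, have quasi-norm at most `C √N`. -/
def HasFlatEstimate (ψ : LipMap 𝕜) (C : ℝ) (y : ℕ → ℕ → L2 𝕜) (x : ℕ → ℕ →₀ 𝕜) : Prop :=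
  ∀ N : ℕ, 1 ≤ N → ∃ k₀, ∀ G : Finset ℕ, (∀ k ∈ G, k₀ ≤ k) → G.card = N →
    ∀ ε : ℕ → 𝕜, (∀ k, ‖ε k‖ = 1) →
      (quasiNorm ψ).toFun (∑ k ∈ G, ε k • PreZ.mk ψ (y N k) (x k)) ≤ C * √N

theorem sum_smul_mk (ψ : LipMap 𝕜) (G : Finset ℕ) (ε : ℕ → 𝕜) (y : ℕ → L2 𝕜) (x : ℕ → ℕ →₀ 𝕜) :
    ∑ k ∈ G, ε k • PreZ.mk ψ (y k) (x k) =
      PreZ.mk ψ (∑ k ∈ G, ε k • y k) (∑ k ∈ G, ε k • x k) :=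
  Prod.ext (map_sum (PreZ.fst ψ) _ _) (map_sum (PreZ.snd ψ) _ _)

namespace HasFlatEstimate

variable {ψ : LipMap 𝕜} {C : ℝ} {y : ℕ → ℕ → L2 𝕜} {x : ℕ → ℕ →₀ 𝕜}

theorem tendsto_coord (h : HasFlatEstimate ψ C y x) (j : ℕ) :
    Filter.Tendsto (fun k => x k j) Filter.atTop (𝓝 0) := by
  refine tendsto_zero_of_unimodular_sums (C := C) fun N hN => ?_
  obtain ⟨k₀, hk₀⟩ := h N hN
  refine ⟨k₀, fun G hG hGN ε hε => ?_⟩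
  have h1 := hk₀ G hG hGN ε hε
  rw [sum_smul_mk, quasiNorm_mk] at h1
  have h2 := norm_coord_le (incl 𝕜 (∑ k ∈ G, ε k • x k)) j
  rw [incl_apply, Finsupp.finsetSum_apply] at h2
  refine h2.trans (le_trans ?_ h1)
  exact le_add_of_nonneg_left (norm_nonneg _)

/-- The bound does not depend on `N`, although the scale `√N` does. If it failed infinitely often,
`N` bad indices along which `Ω` at scale `√N` is almost additive would, for suitable signs, give a
sum of squares both above `D² N` and at most `D² N`. The three parts of `D` come from the flat
estimate, the change of scale, and the additivity error. -/
theorem eventually_norm_sub_OmegaAt_le (h : HasFlatEstimate ψ C y x) {K : ℝ≥0}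
    (hK : LipschitzWith K (ψ : ℝ≥0 → 𝕜)) {N : ℕ} (hN : 1 ≤ N) :
    ∀ᶠ k in Filter.atTop, ‖y N k - OmegaAt ψ √N (x k)‖ ≤ C + K * (1 + C ^ 2) + 1 := by
  by_contra hcon
  rw [Filter.not_eventually] at hcon
  obtain ⟨k₀, hk₀⟩ := h N hN
  have hN' : (1 : ℝ) ≤ N := by exact_mod_cast hN
  have hs : 1 ≤ √(N : ℝ) := Real.one_le_sqrt.2 hN'
  have hs0 : 0 < √(N : ℝ) := by linarith
  have hA := Nat.frequently_atTop_iff_infinite.1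
    (hcon.and_eventually (Filter.eventually_ge_atTop k₀))
  obtain ⟨G, hGA, hGN, hG⟩ := exists_almost_additive ψ hs0 h.tendsto_coord hA N one_pos
  obtain ⟨ε, hε, hle⟩ := exists_sum_sq_le (𝕜 := 𝕜) G fun k => y N k - OmegaAt ψ √N (x k)
  have h1 := hk₀ G (fun k hk => (hGA hk).2) hGN ε hε
  rw [sum_smul_mk, quasiNorm_mk] at h1
  have h2 := hG ε hε
  set u := ∑ k ∈ G, ε k • x k
  have hu : ‖incl 𝕜 u‖ ≤ C * √N := by
    linarith [norm_nonneg (∑ k ∈ G, ε k • y N k - Omega ψ u)]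
  have h3 := norm_Omega_sub_OmegaAt_of_le ψ hK hs0 u hu
  have hC : 0 ≤ C := by
    by_contra hC
    nlinarith [norm_nonneg (incl 𝕜 u)]
  have h4 : ‖∑ k ∈ G, ε k • (y N k - OmegaAt ψ √N (x k))‖ ≤ (C + K * (1 + C ^ 2) + 1) * √N := by
    have e : ∑ k ∈ G, ε k • (y N k - OmegaAt ψ √N (x k)) =
        (∑ k ∈ G, ε k • y N k - Omega ψ u) + (Omega ψ u - OmegaAt ψ √N u) +
        (OmegaAt ψ √N u - ∑ k ∈ G, ε k • OmegaAt ψ √N (x k)) := by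
      simp only [smul_sub, Finset.sum_sub_distrib]
      abel
    rw [e]
    refine (norm_add₃_le).trans ?_
    linarith [norm_nonneg (incl 𝕜 u)]
  set D := C + K * (1 + C ^ 2) + 1 with hD
  have hD0 : 0 ≤ D := by positivity
  have h5 : ‖∑ k ∈ G, ε k • (y N k - OmegaAt ψ √N (x k))‖ ^ 2 ≤ D ^ 2 * N := by
    calc _ ≤ (D * √N) ^ 2 := by gcongr
      _ = _ := by rw [mul_pow, Real.sq_sqrt (by linarith)]
  have h6 : ∑ k ∈ G, D ^ 2 < ∑ k ∈ G, ‖y N k - OmegaAt ψ √N (x k)‖ ^ 2 := by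
    refine Finset.sum_lt_sum_of_nonempty (Finset.card_pos.1 (by omega)) fun k hk => ?_
    have := (hGA hk).1
    rw [not_le] at this
    gcongr
  rw [Finset.sum_const, hGN, nsmul_eq_mul] at h6
  linarith

theorem eventually_norm_incl_le (h : HasFlatEstimate ψ C y x) :
    ∀ᶠ k in Filter.atTop, ‖incl 𝕜 (x k)‖ ≤ C := by
  obtain ⟨k₀, hk₀⟩ := h 1 le_rfl
  filter_upwards [Filter.eventually_ge_atTop k₀] with k hk
  have h1 := hk₀ {k} (by simpa using hk) rfl (fun _ => 1) (by simp)
  rw [Finset.sum_singleton, one_smul, quasiNorm_mk] at h1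
  simp only [Nat.cast_one, Real.sqrt_one, mul_one] at h1
  linarith [norm_nonneg (y 1 k - Omega ψ (x k))]

end HasFlatEstimate

/-- For fixed `N`, far out each approximation error is at most `1 / N`, so `N` of them add at most
`1 ≤ √N`. -/
theorem HasFlatEstimate.of_approx (ψ : LipMap 𝕜) : ∃ C₀ : ℝ, 0 < C₀ ∧
    ∀ {C : ℝ} {w : ℕ → ℕ → Z ψ} {y : ℕ → ℕ → L2 𝕜} {x : ℕ → ℕ →₀ 𝕜},
    (∀ N : ℕ, 1 ≤ N → ∀ G : Finset ℕ, G.card = N → ∀ ε : ℕ → 𝕜, (∀ k, ‖ε k‖ = 1) →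
      ‖∑ k ∈ G, ε k • w N k‖ ≤ C * √N) →
    (∀ N : ℕ, 1 ≤ N → Filter.Tendsto (fun k => w N k - toZ ψ (PreZ.mk ψ (y N k) (x k)))
      Filter.atTop (𝓝 0)) →
    HasFlatEstimate ψ (C₀ * (C + 1)) y x := by
  obtain ⟨C₀, hC₀, hle⟩ := quasiNorm_le_norm ψ
  refine ⟨C₀, hC₀, fun {C w y x} hw hlim N hN => ?_⟩
  have hN' : (1 : ℝ) ≤ N := by exact_mod_cast hN
  have hs : 1 ≤ √(N : ℝ) := Real.one_le_sqrt.2 hN'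
  have hlim' := (hlim N hN).norm
  rw [norm_zero] at hlim'
  obtain ⟨k₀, hk₀⟩ := Filter.eventually_atTop.1
    (hlim'.eventually_le_const (show (0 : ℝ) < 1 / N by positivity))
  refine ⟨k₀, fun G hG hGN ε hε => (hle _).trans ?_⟩
  rw [mul_assoc]
  gcongr
  rw [← norm_toZ, map_sum]
  simp only [ContinuousLinearMap.map_smul]
  have h1 := hw N hN G hGN ε hε
  have h2 : ‖∑ k ∈ G, ε k • (w N k - toZ ψ (PreZ.mk ψ (y N k) (x k)))‖ ≤ 1 := by
    refine (norm_sum_le_of_le G (n := fun _ => 1 / (N : ℝ)) fun k hk => ?_).trans_eq ?_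
    · rw [norm_smul, hε, one_mul]
      exact hk₀ k (hG k hk)
    · rw [Finset.sum_const, hGN, nsmul_eq_mul]
      field_simp
  have e : ∑ k ∈ G, ε k • toZ ψ (PreZ.mk ψ (y N k) (x k)) = ∑ k ∈ G, ε k • w N k -
      ∑ k ∈ G, ε k • (w N k - toZ ψ (PreZ.mk ψ (y N k) (x k))) := by
    simp only [smul_sub, Finset.sum_sub_distrib]
    abel
  rw [e]
  refine (norm_sub_le _ _).trans ?_
  linarith

/-! ### Bi-Lipschitz maps and strict singularity of the quotient map -/

theorem norm_incl_le_of_biLipschitz (ψ : LipMap 𝕜) {b : ℝ} (hb : 0 < b)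
    (hψ : ∀ s t : ℝ≥0, b * dist s t ≤ dist ((ψ : ℝ≥0 → 𝕜) s) ((ψ : ℝ≥0 → 𝕜) t))
    {r s : ℝ} (hr : 0 < r) (hrs : r ≤ s) {x : ℕ →₀ 𝕜} (hx : ∀ n, ‖x n‖ ≤ r) :
    b * Real.log (s / r) * ‖incl 𝕜 x‖ ≤ ‖OmegaAt ψ s x - OmegaAt ψ r x‖ := by
  have hs : 0 < s := hr.trans_le hrs
  have hlog : 0 ≤ b * Real.log (s / r) :=
    mul_nonneg hb.le (Real.log_nonneg ((one_le_div hr).2 hrs))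
  rcases hlog.eq_or_lt with h0 | h0
  · rw [← h0, zero_mul]
    exact norm_nonneg _
  rw [← le_div_iff₀' h0, ← inv_mul_eq_div]
  refine norm_le_of_coord (inv_nonneg.2 hlog) fun n => ?_
  rw [inv_mul_eq_div, le_div_iff₀' h0]
  change _ * ‖x n‖ ≤ ‖x n * _ - x n * _‖
  rcases eq_or_ne (x n) 0 with h | h
  · simp [h]
  have hxn := norm_pos_iff.2 h
  rw [← mul_sub, norm_mul, mul_comm, ← dist_eq_norm]
  gcongr
  refine le_trans ?_ (hψ _ _)
  gcongr
  -- Since `‖x n‖ ≤ r ≤ s`, `Real.toNNReal` truncates neither argument, and they differ by exactly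
  -- `log (s / r)`.
  have h1 : 0 ≤ -Real.log (‖x n‖ / r) := by
    rw [Left.nonneg_neg_iff]
    exact Real.log_nonpos (by positivity) ((div_le_one hr).2 (hx n))
  have h2 : 0 ≤ -Real.log (‖x n‖ / s) := by
    rw [Left.nonneg_neg_iff]
    exact Real.log_nonpos (by positivity) ((div_le_one hs).2 ((hx n).trans hrs))
  rw [NNReal.dist_eq, Real.coe_toNNReal _ h1, Real.coe_toNNReal _ h2]
  refine le_trans (le_of_eq ?_) (le_abs_self _)
  rw [Real.log_div hxn.ne' hr.ne', Real.log_div hxn.ne' hs.ne', Real.log_div hs.ne' hr.ne']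
  ring

theorem exists_approx_sequence (ψ : LipMap 𝕜) (w : ℕ → Z ψ) : ∃ (y : ℕ → L2 𝕜) (x : ℕ → ℕ →₀ 𝕜),
    Filter.Tendsto (fun k => w k - toZ ψ (PreZ.mk ψ (y k) (x k))) Filter.atTop (𝓝 0) := by
  choose z hz using fun k : ℕ =>
    exists_toZ_norm_sub_lt ψ (w k) (ε := 1 / ((k : ℝ) + 1)) (by positivity)
  exact ⟨fun k => PreZ.fst ψ (z k), fun k => PreZ.snd ψ (z k),
    squeeze_zero_norm (fun k => (hz k).le) tendsto_one_div_add_atTop_nhds_zero_nat⟩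

theorem exists_nat_log_ge (R : ℝ) : ∃ N : ℕ, 1 ≤ N ∧ R ≤ Real.log √N := by
  obtain ⟨N, hN⟩ := exists_nat_ge (max (Real.exp R ^ 2) 1)
  have h1 : (1 : ℝ) ≤ N := (le_max_right _ _).trans hN
  refine ⟨N, by exact_mod_cast h1, ?_⟩
  rw [Real.le_log_iff_exp_le (Real.sqrt_pos.2 (by linarith))]
  exact Real.le_sqrt_of_sq_le ((le_max_left _ _).trans hN)

theorem log_sqrt_mul_div {N M : ℕ} (hN : 1 ≤ N) :
    Real.log (√((N * M : ℕ) : ℝ) / √N) = Real.log √M := by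
  have : 0 < √(N : ℝ) := Real.sqrt_pos.2 (by exact_mod_cast hN)
  rw [Nat.cast_mul, Real.sqrt_mul (by positivity), mul_div_cancel_left₀ _ this.ne']

/-- If `φ` is bi-Lipschitz, then `q` maps sequences with flat upper `2`-estimates to null
sequences. -/
theorem tendsto_qMap_zero {ψ : LipMap 𝕜} (hψ : IsBiLipschitz ψ) {C : ℝ} {w : ℕ → Z ψ}
    (hw : ∀ G : Finset ℕ, ∀ ε : ℕ → 𝕜, (∀ k, ‖ε k‖ = 1) →
      ‖∑ k ∈ G, ε k • w k‖ ≤ C * √(G.card : ℝ)) :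
    Filter.Tendsto (fun k => qMap ψ (w k)) Filter.atTop (𝓝 0) := by
  obtain ⟨b, hb, hbψ⟩ := hψ
  obtain ⟨-, K, hK⟩ := ψ.2
  obtain ⟨y, x, hyx⟩ := exists_approx_sequence ψ w
  obtain ⟨C₀, hC₀, happ⟩ := HasFlatEstimate.of_approx ψ
  have hflat : HasFlatEstimate ψ (C₀ * (C + 1)) (fun _ => y) x :=
    happ (w := fun _ => w) (fun N _ G hG ε hε => hG ▸ hw G ε hε) fun N _ => hyx
  set D := C₀ * (C + 1)
  set E := D + K * (1 + D ^ 2) + 1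
  -- The base scale `√N` has to dominate `‖x k‖ ≤ D`, so that all arguments of `ψ` are nonnegative
  -- there.
  obtain ⟨N, hN, hDN⟩ := exists_nat_log_ge D
  have hsN : 0 < √(N : ℝ) := Real.sqrt_pos.2 (by exact_mod_cast hN)
  have hDN : D ≤ √N := hDN.trans (Real.log_le_self hsN.le)
  have hx : Filter.Tendsto (fun k => incl 𝕜 (x k)) Filter.atTop (𝓝 0) := by
    rw [tendsto_zero_iff_norm_tendsto_zero]
    refine tendsto_order.2 ⟨fun a ha => Filter.Eventually.of_forall fun k =>
      ha.trans_le (norm_nonneg _), fun a ha => ?_⟩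
    -- With this `M`, a vector with `a ≤ ‖x k‖` would separate the scales `√N` and `√(NM)` by more
    -- than `2 * E`.
    obtain ⟨M, hM, hMR⟩ := exists_nat_log_ge ((2 * E + 1) / (b * a))
    have hNM : 1 ≤ N * M := Nat.mul_pos hN hM
    filter_upwards [hflat.eventually_norm_sub_OmegaAt_le hK hN,
      hflat.eventually_norm_sub_OmegaAt_le hK hNM, hflat.eventually_norm_incl_le] with k h1 h2 h3
    have hle : √(N : ℝ) ≤ √((N * M : ℕ) : ℝ) :=
      Real.sqrt_le_sqrt (by exact_mod_cast Nat.le_mul_of_pos_right N hM)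
    have h4 := norm_incl_le_of_biLipschitz ψ hb hbψ hsN hle (x := x k)
      fun n => (norm_coord_le (incl 𝕜 (x k)) n).trans (h3.trans hDN)
    rw [log_sqrt_mul_div hN] at h4
    have h5 : ‖OmegaAt ψ √((N * M : ℕ) : ℝ) (x k) - OmegaAt ψ √N (x k)‖ ≤ 2 * E := by
      have := norm_sub_le (y k - OmegaAt ψ √N (x k)) (y k - OmegaAt ψ √((N * M : ℕ) : ℝ) (x k))
      rw [sub_sub_sub_cancel_left] at this
      linarith
    rw [div_le_iff₀ (by positivity)] at hMR
    by_contra! hcon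
    have hE : 0 ≤ E := by linarith [norm_nonneg (y k - OmegaAt ψ √N (x k))]
    have hlog : 0 ≤ Real.log √(M : ℝ) := by
      by_contra! hneg
      have : Real.log √(M : ℝ) * (b * a) ≤ 0 :=
        mul_nonpos_of_nonpos_of_nonneg hneg.le (by positivity)
      linarith
    have h6 : b * Real.log √M * a ≤ b * Real.log √M * ‖incl 𝕜 (x k)‖ := by gcongr
    linarith
  have h1 : Filter.Tendsto (fun k => qMap ψ (w k - toZ ψ (PreZ.mk ψ (y k) (x k))) +
      incl 𝕜 (x k)) Filter.atTop (𝓝 (qMap ψ 0 + 0)) :=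
    (((qMap ψ).continuous.tendsto 0).comp hyx).add hx
  rw [map_zero, add_zero] at h1
  refine h1.congr fun k => ?_
  rw [map_sub, qMap_toZ_mk, sub_add_cancel]

theorem norm_sum_smul_orthonormal {E : Type*} [NormedAddCommGroup E] [InnerProductSpace 𝕜 E]
    {u : ℕ → E} (hu : Orthonormal 𝕜 u) (G : Finset ℕ) {ε : ℕ → 𝕜} (hε : ∀ k, ‖ε k‖ = 1) :
    ‖∑ k ∈ G, ε k • u k‖ = √(G.card : ℝ) := by
  have h := hu.inner_sum ε ε G
  rw [inner_self_eq_norm_sq_to_K] at h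
  have h2 : ∑ k ∈ G, (starRingEnd 𝕜) (ε k) * ε k = ((G.card : ℝ) : 𝕜) := by
    simp [RCLike.conj_mul, hε]
  rw [h2] at h
  have h3 : ‖∑ k ∈ G, ε k • u k‖ ^ 2 = (G.card : ℝ) := by exact_mod_cast h
  rw [← h3, Real.sqrt_sq (norm_nonneg _)]

theorem exists_orthonormal_sequence {E : Type*} [NormedAddCommGroup E] [InnerProductSpace 𝕜 E]
    (hE : ¬ FiniteDimensional 𝕜 E) : ∃ u : ℕ → E, Orthonormal 𝕜 u := by
  let b := Module.Basis.ofVectorSpace 𝕜 E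
  have : Infinite (Module.Basis.ofVectorSpaceIndex 𝕜 E) := by
    by_contra hfin
    rw [not_infinite_iff_finite] at hfin
    exact hE (Module.Finite.of_basis b)
  exact ⟨_, InnerProductSpace.gramSchmidtNormed_orthonormal
    (b.linearIndependent.comp _ (Infinite.natEmbedding _).injective)⟩

/-- If `q` were an isomorphism on an infinite-dimensional `W`, the preimages in `W` of an
orthonormal sequence of `q(W)` would have flat upper `2`-estimates, so their images would tend to
zero. -/
theorem strictlySingular_qMap {ψ : LipMap 𝕜} (hψ : IsBiLipschitz ψ) :
    StrictlySingular (qMap ψ) := by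
  intro W hW hemb
  let L : W →L[𝕜] L2 𝕜 := (qMap ψ).comp W.subtypeL
  have hL : Topology.IsEmbedding L := hemb
  obtain ⟨C, hanti⟩ := ContinuousLinearMap.antilipschitz_of_isEmbedding (𝕜 := 𝕜) (E := W) (Fₗ := L2 𝕜) L hL
  have hV : ¬ FiniteDimensional 𝕜 (LinearMap.range L.toLinearMap) := fun hfin =>
    hW (LinearEquiv.ofInjective L.toLinearMap hL.injective).symm.finiteDimensional
  obtain ⟨u, hu⟩ := exists_orthonormal_sequence hV
  choose w hw using fun k => (u k).2
  have hw : ∀ k, L (w k) = u k := hw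
  have hu' : Orthonormal 𝕜 fun k => ((u k : LinearMap.range L.toLinearMap) : L2 𝕜) :=
    hu.comp_linearIsometry (LinearMap.range L.toLinearMap).subtypeₗᵢ
  have hlim := tendsto_qMap_zero hψ (C := C) (w := fun k => (w k : Z ψ)) fun G ε hε => by
    have h1 := hanti.le_mul_norm (map_zero L) (∑ k ∈ G, ε k • w k)
    rw [map_sum] at h1
    simp only [ContinuousLinearMap.map_smul, hw] at h1
    rw [norm_sum_smul_orthonormal hu' G hε] at h1
    simpa using h1
  have h1 := hlim.norm
  have h2 : (fun k => ‖qMap ψ (w k : Z ψ)‖) = fun _ => 1 := by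
    ext k
    rw [show qMap ψ (w k : Z ψ) = u k from hw k]
    exact hu'.1 k
  rw [h2, norm_zero] at h1
  exact one_ne_zero (tendsto_nhds_unique tendsto_const_nhds h1)

theorem isSingularTwistedHilbert_of_isBiLipschitz.{u} {𝕜 : Type u} [RCLike 𝕜] {φ : LipMap 𝕜}
    (hφ : IsBiLipschitz φ) : IsSingularTwistedHilbert φ :=
  ⟨isTwistedHilbert_Z φ, strictlySingular_qMap hφ⟩

/-! ### Embeddings of `Z(φ)` into `Z(ψ)` -/

theorem sum_single_apply (G : Finset ℕ) (ε : ℕ → 𝕜) (j : ℕ) :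
    (∑ k ∈ G, ε k • Finsupp.single k (1 : 𝕜)) j = if j ∈ G then ε j else 0 := by
  rw [Finsupp.finsetSum_apply]
  simp [Finsupp.single_apply]

theorem norm_incl_sum_single (G : Finset ℕ) {ε : ℕ → 𝕜} (hε : ∀ k, ‖ε k‖ = 1) :
    ‖incl 𝕜 (∑ k ∈ G, ε k • Finsupp.single k (1 : 𝕜))‖ = √(G.card : ℝ) := by
  have h : ‖incl 𝕜 (∑ k ∈ G, ε k • Finsupp.single k (1 : 𝕜))‖ ^ 2 = (G.card : ℝ) := by
    rw [norm_sq_incl _ (s := G)]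
    · rw [Finset.sum_congr rfl (g := fun _ => (1 : ℝ)) fun j hj => by
        rw [sum_single_apply, if_pos hj, hε, one_pow]]
      simp
    · intro j hj
      by_contra hjG
      rw [Finsupp.mem_support_iff, sum_single_apply, if_neg hjG] at hj
      exact hj rfl
  rw [← h, Real.sqrt_sq (norm_nonneg _)]

theorem Omega_sum_single (φ : LipMap 𝕜) (G : Finset ℕ) {ε : ℕ → 𝕜} (hε : ∀ k, ‖ε k‖ = 1) :
    Omega φ (∑ k ∈ G, ε k • Finsupp.single k (1 : 𝕜)) =
      (φ : ℝ≥0 → 𝕜) (Real.toNNReal (Real.log √(G.card : ℝ))) •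
        incl 𝕜 (∑ k ∈ G, ε k • Finsupp.single k (1 : 𝕜)) := by
  ext j
  rw [Omega_apply, norm_incl_sum_single G hε, lp.coeFn_smul, Pi.smul_apply, incl_apply,
    smul_eq_mul, mul_comm]
  by_cases hj : j ∈ G
  · rw [sum_single_apply, if_pos hj, hε, one_div, Real.log_inv, neg_neg]
  · rw [sum_single_apply, if_neg hj, mul_zero, mul_zero]

/-- Averaging: if every coordinate in the support violated the bound for some `N`, summing squares
would contradict `∑ ‖u N‖² ≤ |S| E² ‖x‖²`. The factor `√|S|` is the price for one coordinate serving
all `N ∈ S`. -/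
theorem exists_coord_le_of_norm_le {x : ℕ →₀ 𝕜} (hx : x ≠ 0) {S : Finset ℕ} {E : ℝ}
    (hE : 0 ≤ E) {u : ℕ → L2 𝕜} (hu : ∀ N ∈ S, ‖u N‖ ≤ E * ‖incl 𝕜 x‖) :
    ∃ i, x i ≠ 0 ∧ ∀ N ∈ S, ‖(u N : ℕ → 𝕜) i‖ ≤ E * √(S.card : ℝ) * ‖x i‖ := by
  by_contra! hcon
  have h1 : ∀ i ∈ x.support, E ^ 2 * S.card * ‖x i‖ ^ 2 < ∑ N ∈ S, ‖(u N : ℕ → 𝕜) i‖ ^ 2 := by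
    intro i hi
    obtain ⟨N, hN, hlt⟩ := hcon i (Finsupp.mem_support_iff.1 hi)
    calc E ^ 2 * S.card * ‖x i‖ ^ 2 = (E * √(S.card : ℝ) * ‖x i‖) ^ 2 := by
          rw [mul_pow, mul_pow, Real.sq_sqrt (by positivity)]
      _ < ‖(u N : ℕ → 𝕜) i‖ ^ 2 := by gcongr
      _ ≤ _ := Finset.single_le_sum (f := fun N => ‖(u N : ℕ → 𝕜) i‖ ^ 2)
          (fun _ _ => by positivity) hN
  have h2 := Finset.sum_lt_sum_of_nonempty (Finsupp.support_nonempty_iff.2 hx) h1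
  rw [← Finset.mul_sum, ← norm_sq_incl x subset_rfl, Finset.sum_comm] at h2
  have h3 : ∑ N ∈ S, ∑ i ∈ x.support, ‖(u N : ℕ → 𝕜) i‖ ^ 2 ≤
      ∑ N ∈ S, (E * ‖incl 𝕜 x‖) ^ 2 := Finset.sum_le_sum fun N hN =>
    (sum_norm_sq_le (u N) _).trans (by gcongr; exact hu N hN)
  rw [Finset.sum_const, nsmul_eq_mul] at h3
  linarith [mul_pow E ‖incl 𝕜 x‖ 2]

theorem exists_shift_approx {φ ψ : LipMap 𝕜} (hφ : IsBiLipschitz φ) (hψ : IsBiLipschitz ψ)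
    (h : EmbedsInto 𝕜 (Z φ) (Z ψ)) : ∃ c₀ D : ℝ, ∀ S : Finset ℕ, (∀ N ∈ S, 1 ≤ N) →
      ∃ (l : 𝕜) (c : ℝ), -c₀ ≤ c ∧ ∀ N ∈ S,
        ‖l * (φ : ℝ≥0 → 𝕜) (Real.toNNReal (Real.log √N)) -
          ((ψ : ℝ≥0 → 𝕜) (Real.toNNReal (Real.log √N + c)) - (ψ : ℝ≥0 → 𝕜) (Real.toNNReal c))‖
        ≤ D * √(S.card : ℝ) := by
  obtain ⟨T, hT⟩ := h
  obtain ⟨A, hanti⟩ := ContinuousLinearMap.antilipschitz_of_isEmbedding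
    (𝕜 := 𝕜) (E := Z φ) (Fₗ := Z ψ) T hT
  obtain ⟨Ai, hAi⟩ := exists_norm_le_iMap φ
  obtain ⟨b, hb, hbφ⟩ := hφ
  obtain ⟨-, K, hK⟩ := ψ.2
  set e : ℕ → ℕ →₀ 𝕜 := fun k => Finsupp.single k 1 with he
  set f : ℕ → 𝕜 := fun N => (φ : ℝ≥0 → 𝕜) (Real.toNNReal (Real.log √(N : ℝ))) with hf
  set w : ℕ → Z ψ := fun k => T (iMap φ (incl 𝕜 (e k))) with hw
  -- The images of the unit vectors of `ℓ₂` are asymptotically in the range of `i`.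
  have hq := tendsto_qMap_zero hψ (C := ‖T.comp (iMap φ)‖) (w := w) fun G ε hε => by
    have h1 : ∑ k ∈ G, ε k • w k = T.comp (iMap φ) (incl 𝕜 (∑ k ∈ G, ε k • e k)) := by
      simp only [map_sum, _root_.map_smul, hw, ContinuousLinearMap.comp_apply]
    rw [h1, ← norm_incl_sum_single G hε]
    exact (T.comp (iMap φ)).le_opNorm _
  choose z hz using fun k : ℕ => exists_norm_sub_iMap_lt ψ (w k)
    (ε := 1 / ((k : ℝ) + 1)) (by positivity)
  have hwz : Filter.Tendsto (fun k => w k - iMap ψ (z k)) Filter.atTop (𝓝 0) := by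
    refine squeeze_zero_norm (fun k => (hz k).le) ?_
    simpa using hq.norm.add tendsto_one_div_add_atTop_nhds_zero_nat
  obtain ⟨y, x, hyx⟩ := exists_approx_sequence ψ fun k => T (toZ φ (PreZ.mk φ 0 (e k)))
  obtain ⟨C₀, hC₀, happ⟩ := HasFlatEstimate.of_approx ψ
  -- For `N` unit vectors with sum `u`, adding `f N` times `(u, 0)` turns `(0, u)` into `(Ω_φ u,
  -- u)`, of norm at most `√N`.
  have hflat : HasFlatEstimate ψ (C₀ * (‖T‖ + 1)) (fun N k => y k + f N • z k) x := by
    refine happ (w := fun N k => T (toZ φ (PreZ.mk φ 0 (e k))) + f N • w k)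
      (fun N hN G hG ε hε => ?_) fun N hN => ?_
    · have h1 : ∑ k ∈ G, ε k • (T (toZ φ (PreZ.mk φ 0 (e k))) + f N • w k) =
          T (toZ φ (PreZ.mk φ (Omega φ (∑ k ∈ G, ε k • e k)) (∑ k ∈ G, ε k • e k))) := by
        rw [Omega_sum_single φ G hε, hG]
        have h2 : ∀ k, ε k • (T (toZ φ (PreZ.mk φ 0 (e k))) + f N • w k) =
            T (toZ φ (ε k • PreZ.mk φ (f N • incl 𝕜 (e k)) (e k))) := fun k => by
          have h3 : PreZ.mk φ (f N • incl 𝕜 (e k)) (e k) =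
              PreZ.mk φ 0 (e k) + f N • PreZ.mk φ (incl 𝕜 (e k)) 0 :=
            Prod.ext (zero_add _).symm ((add_zero _).symm.trans
              (congrArg _ (smul_zero (f N)).symm))
          rw [h3]
          simp only [_root_.map_smul, map_add, hw, iMap_apply]
        simp only [h2]
        rw [← map_sum, ← map_sum, sum_smul_mk]
        congr 3
        rw [map_sum, Finset.smul_sum]
        refine Finset.sum_congr rfl fun k _ => ?_
        rw [smul_comm, _root_.map_smul]
      rw [h1]
      refine (T.le_opNorm _).trans ?_
      gcongr
      refine (norm_Omega_mk_le φ _).trans_eq ?_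
      rw [norm_incl_sum_single G hε, hG]
    · have h1 := hyx.add (hwz.const_smul (f N))
      rw [smul_zero, add_zero] at h1
      refine h1.congr fun k => ?_
      have h3 : PreZ.mk ψ (y k + f N • z k) (x k) =
          PreZ.mk ψ (y k) (x k) + f N • PreZ.mk ψ (z k) 0 :=
        Prod.ext rfl ((add_zero _).symm.trans (congrArg _ (smul_zero (f N)).symm))
      rw [h3, map_add, _root_.map_smul, iMap_apply, smul_sub]
      abel
  set C := C₀ * (‖T‖ + 1)
  set E := C + K * (1 + C ^ 2) + 1
  have hC : 0 ≤ C := by positivity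
  have hE : 0 < E := by positivity
  -- At `N = 1` the estimate controls `y k` alone, so subtracting it eliminates `y k` from all the
  -- others.
  have hf1 : f 1 = 0 := by simpa [hf] using φ.2.1
  have hdiff : ∀ N, 1 ≤ N → ∀ᶠ k in Filter.atTop,
      ‖f N • z k - (OmegaAt ψ √N (x k) - OmegaAt ψ 1 (x k))‖ ≤ 2 * E := by
    intro N hN
    filter_upwards [hflat.eventually_norm_sub_OmegaAt_le hK hN,
      hflat.eventually_norm_sub_OmegaAt_le hK le_rfl] with k h1 h2
    simp only [hf1, zero_smul, add_zero, Nat.cast_one, Real.sqrt_one] at h2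
    have h3 := norm_sub_le (y k + f N • z k - OmegaAt ψ √N (x k)) (y k - OmegaAt ψ 1 (x k))
    have e1 : y k + f N • z k - OmegaAt ψ √N (x k) - (y k - OmegaAt ψ 1 (x k)) =
        f N • z k - (OmegaAt ψ √N (x k) - OmegaAt ψ 1 (x k)) := by abel
    rw [e1] at h3
    linarith
  -- The vectors `z k` are bounded below.
  obtain ⟨δ, hδ, hzδ⟩ : ∃ δ : ℝ, 0 < δ ∧ ∀ᶠ k in Filter.atTop, δ ≤ ‖z k‖ := by
    refine ⟨1 / (2 * (Ai * A + 1) * (‖iMap ψ‖ + 1)), by positivity, ?_⟩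
    have h0 := hwz.norm
    rw [norm_zero] at h0
    filter_upwards [h0.eventually_le_const
      (show (0 : ℝ) < 1 / (2 * (Ai * A + 1)) by positivity)] with k hk
    have h1 : 1 ≤ (Ai * A + 1) * ‖w k‖ := by
      have h2 := hAi (incl 𝕜 (e k))
      have h3 := hanti.le_mul_norm (map_zero T) (iMap φ (incl 𝕜 (e k)))
      have h4 : ‖incl 𝕜 (e k)‖ = 1 := by
        simpa [he] using norm_incl_sum_single {k} (ε := fun _ => (1 : 𝕜)) (by simp)
      rw [h4] at h2
      have h5 : (Ai : ℝ) * ‖iMap φ (incl 𝕜 (e k))‖ ≤ Ai * (A * ‖w k‖) := by gcongr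
      linarith [norm_nonneg (w k)]
    have h2 : ‖w k‖ ≤ ‖w k - iMap ψ (z k)‖ + (‖iMap ψ‖ + 1) * ‖z k‖ := by
      have h3 := norm_le_norm_sub_add (w k) (iMap ψ (z k))
      have h4 := (iMap ψ).le_opNorm (z k)
      linarith [norm_nonneg (z k)]
    rw [div_le_iff₀ (by positivity)]
    rw [le_div_iff₀ (by positivity)] at hk
    have h3 := mul_le_mul_of_nonneg_left h2 (by positivity : 0 ≤ (Ai * A + 1 : ℝ))
    linarith
  -- The vectors `x k` are bounded below.
  obtain ⟨δ', hδ', hxδ⟩ : ∃ δ' : ℝ, 0 < δ' ∧ ∀ᶠ k in Filter.atTop, δ' ≤ ‖incl 𝕜 (x k)‖ := by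
    -- Now `‖f N • z k‖` is at least `2 * E + 1`, so `Ω_{√N} x_k - Ω_1 x_k`, of norm at most `K log
    -- √N ‖x k‖`, has norm at least `1`.
    obtain ⟨N, hN, hNR⟩ := exists_nat_log_ge ((2 * E + 1) / (b * δ))
    have hpos : 0 < Real.log √(N : ℝ) := lt_of_lt_of_le (by positivity) hNR
    refine ⟨1 / (K * Real.log √N + 1), by positivity, ?_⟩
    filter_upwards [hdiff N hN, hzδ] with k h1 h2
    rw [div_le_iff₀ (by positivity)]
    rw [div_le_iff₀ (by positivity)] at hNR
    have h3 := norm_OmegaAt_sub_OmegaAt ψ hK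
      (Real.sqrt_pos.2 (by exact_mod_cast hN) : 0 < √(N : ℝ)) one_pos (x k)
    rw [div_one, abs_of_pos hpos] at h3
    have h4 : b * Real.log √N ≤ ‖f N‖ := by
      have := hbφ (Real.toNNReal (Real.log √(N : ℝ))) 0
      rwa [φ.2.1, dist_zero_right, NNReal.dist_eq, NNReal.coe_zero, sub_zero,
        Real.coe_toNNReal _ hpos.le, abs_of_pos hpos] at this
    have h5 : b * Real.log √N * δ ≤ ‖f N • z k‖ := by
      rw [norm_smul]
      gcongr
    have h6 := norm_le_norm_sub_add (f N • z k) (OmegaAt ψ √N (x k) - OmegaAt ψ 1 (x k))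
    linarith [norm_nonneg (incl 𝕜 (x k))]
  refine ⟨Real.log (C + 1), 2 * E / δ', fun S hS => ?_⟩
  obtain ⟨k, hk, hkx, hkC⟩ := ((Filter.eventually_all_finset S).2 fun N hN =>
    hdiff N (hS N hN)).and (hxδ.and hflat.eventually_norm_incl_le) |>.exists
  have hx0 : x k ≠ 0 := by
    rintro h0
    rw [h0, map_zero, norm_zero] at hkx
    linarith
  obtain ⟨i, hi, hiS⟩ := exists_coord_le_of_norm_le hx0 (S := S) (E := 2 * E / δ')
    (by positivity)
    (u := fun N => f N • z k - (OmegaAt ψ √N (x k) - OmegaAt ψ 1 (x k))) fun N hN => by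
      refine (hk N hN).trans ?_
      rw [div_mul_eq_mul_div, le_div_iff₀ hδ']
      gcongr
  have hxi : 0 < ‖x k i‖ := norm_pos_iff.2 hi
  -- Coordinate `i` is divided by `x k i`; passing from scale `1` to scale `√N` shifts the argument
  -- of `ψ` from `c` to `log √N + c`.
  refine ⟨(z k : ℕ → 𝕜) i / x k i, -Real.log ‖x k i‖, ?_, fun N hN => ?_⟩
  · rw [neg_le_neg_iff]
    refine Real.log_le_log hxi ?_
    have := norm_coord_le (incl 𝕜 (x k)) i
    rw [incl_apply] at this
    linarith
  · have h1 := hiS N hN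
    rw [← div_le_iff₀ hxi, ← norm_div] at h1
    refine le_trans (le_of_eq ?_) h1
    congr 1
    have hN0 : √(N : ℝ) ≠ 0 := (Real.sqrt_pos.2 (by exact_mod_cast hS N hN)).ne'
    have h2 : -Real.log (‖x k i‖ / √N) = Real.log √N + -Real.log ‖x k i‖ := by
      rw [Real.log_div hxi.ne' hN0]
      ring
    have h3 : (f N • z k - (OmegaAt ψ √N (x k) - OmegaAt ψ 1 (x k)) : L2 𝕜) i =
      f N * (z k : ℕ → 𝕜) i -
        (x k i * (ψ : ℝ≥0 → 𝕜) (Real.toNNReal (-Real.log (‖x k i‖ / √N))) -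
         x k i * (ψ : ℝ≥0 → 𝕜) (Real.toNNReal (-Real.log (‖x k i‖ / 1)))) := rfl
    rw [h3, h2, div_one]
    field_simp
    rfl

/-! ### Polynomials in `log (1 + t)` -/

section LogPoly

open Polynomial

theorem tendsto_log_pow_div (n : ℕ) :
    Filter.Tendsto (fun t : ℝ => Real.log (1 + t) ^ n / (1 + t)) Filter.atTop (𝓝 0) :=
  (Real.isLittleO_pow_log_id_atTop (n := n)).tendsto_div_nhds_zero.comp
    (Filter.tendsto_atTop_add_const_left _ 1 Filter.tendsto_id)

theorem tendsto_eval_log_div (q : 𝕜[X]) : Filter.Tendsto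
    (fun t : ℝ => q.eval ((Real.log (1 + t) : ℝ) : 𝕜) / (t : 𝕜)) Filter.atTop (𝓝 0) := by
  induction q using Polynomial.induction_on' with
  | add p q hp hq =>
    have := hp.add hq
    rw [add_zero] at this
    exact this.congr fun t => by rw [eval_add, add_div]
  | monomial n a =>
    have h := ((tendsto_log_pow_div n).mul_const 2).const_mul ‖a‖
    rw [zero_mul, mul_zero] at h
    refine squeeze_zero_norm' ?_ h
    filter_upwards [Filter.eventually_ge_atTop 1] with t ht
    have hlog : 0 ≤ Real.log (1 + t) := Real.log_nonneg (by linarith)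
    rw [eval_monomial, norm_div, norm_mul, norm_pow, RCLike.norm_ofReal, RCLike.norm_ofReal,
      abs_of_nonneg hlog, abs_of_nonneg (by linarith : 0 ≤ t), mul_div_assoc]
    gcongr
    rw [div_mul_eq_mul_div, div_le_div_iff₀ (by linarith) (by linarith)]
    have := pow_nonneg hlog n
    nlinarith

/-- The increment of `log (1 + t)` over `[c, s + c]` is of order `1 / c`, which beats the power of
the logarithm produced by differencing a monomial. -/
theorem tendsto_eval_log_sub (p : ℝ[X]) {s : ℝ} (hs : 0 ≤ s) : Filter.Tendsto
    (fun c : ℝ => p.eval (Real.log (1 + (s + c))) - p.eval (Real.log (1 + c)))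
    Filter.atTop (𝓝 0) := by
  induction p using Polynomial.induction_on' with
  | add p q hp hq =>
    have := hp.add hq
    rw [add_zero] at this
    exact this.congr fun t => by rw [eval_add, eval_add]; ring
  | monomial n a =>
    have h := (((tendsto_log_pow_div (n - 1)).comp
      (Filter.tendsto_atTop_add_const_left _ s Filter.tendsto_id)).const_mul (2 * s * n)).const_mul |a|
    rw [mul_zero, mul_zero] at h
    refine squeeze_zero_norm' ?_ h
    filter_upwards [Filter.eventually_ge_atTop s] with c hc
    have h0 : 0 ≤ Real.log (1 + c) := Real.log_nonneg (by linarith)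
    have h1 : Real.log (1 + c) ≤ Real.log (1 + (s + c)) :=
      Real.log_le_log (by linarith) (by linarith)
    have h2 : Real.log (1 + (s + c)) - Real.log (1 + c) ≤ 2 * s / (1 + (s + c)) := by
      rw [← Real.log_div (by linarith) (by linarith)]
      refine (Real.log_le_sub_one_of_pos (div_pos (by linarith) (by linarith))).trans ?_
      rw [div_sub_one (by linarith), div_le_div_iff₀ (by linarith) (by linarith)]
      nlinarith
    have h3 := abs_pow_sub_pow_le (Real.log (1 + (s + c))) (Real.log (1 + c)) n
    rw [abs_of_nonneg h0, abs_of_nonneg (h0.trans h1), max_eq_left h1,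
      abs_of_nonneg (sub_nonneg.2 h1)] at h3
    rw [eval_monomial, eval_monomial, ← mul_sub, norm_mul, Real.norm_eq_abs, Real.norm_eq_abs]
    gcongr
    refine h3.trans ?_
    have h4 : 0 ≤ Real.log (1 + (s + c)) ^ (n - 1) := pow_nonneg (h0.trans h1) _
    calc _ ≤ 2 * s / (1 + (s + c)) * n * Real.log (1 + (s + c)) ^ (n - 1) := by gcongr
      _ = _ := by
        simp only [Function.comp_apply, id]
        ring

theorem tendsto_abs_eval_log {p : ℝ[X]} (h0 : p.coeff 0 = 0) (hp : p ≠ 0) :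
    Filter.Tendsto (fun t : ℝ => |p.eval (Real.log (1 + t))|) Filter.atTop Filter.atTop := by
  refine p.tendsto_norm_atTop ?_ ?_
  · by_contra hdeg
    rw [eq_C_of_degree_le_zero (not_lt.1 hdeg), h0, C_0] at hp
    exact hp rfl
  · exact tendsto_norm_atTop_atTop.comp (Real.tendsto_log_atTop.comp
      (Filter.tendsto_atTop_add_const_left _ 1 Filter.tendsto_id))

/-- The function `p(1) t + p(log(1 + t))`. -/
def logPoly (p : ℝ[X]) (t : ℝ) : ℝ := p.eval 1 * t + p.eval (Real.log (1 + t))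

theorem tendsto_logPoly_div (p : ℝ[X]) :
    Filter.Tendsto (fun t : ℝ => logPoly p t / t) Filter.atTop (𝓝 (p.eval 1)) := by
  have h := (tendsto_eval_log_div (𝕜 := ℝ) p).const_add (p.eval 1)
  rw [add_zero] at h
  refine h.congr' ?_
  filter_upwards [Filter.eventually_gt_atTop 0] with t ht
  simp only [logPoly, RCLike.ofReal_real_eq_id, id]
  field_simp

/-- `φ = p(1) t + p(log(1 + t))` for a polynomial `p` with `p(0) = 0`, `p(1) > 0`, such that
`p(log(1 + t))` is increasing. -/
structure IsLogPoly (φ : LipMap 𝕜) (p : ℝ[X]) : Prop where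
  coeff_zero : p.coeff 0 = 0
  eval_one_pos : 0 < p.eval 1
  mono : Monotone fun t : ℝ≥0 => p.eval (Real.log (1 + t))
  apply_eq : ∀ t : ℝ≥0, (φ : ℝ≥0 → 𝕜) t = ((logPoly p t : ℝ) : 𝕜)

theorem logPoly_add (p r : ℝ[X]) (t : ℝ) : logPoly (p + r) t = logPoly p t + logPoly r t := by
  simp only [logPoly, eval_add]
  ring

theorem logPoly_smul (c : ℝ) (p : ℝ[X]) (t : ℝ) : logPoly (c • p) t = c * logPoly p t := by
  simp only [logPoly, eval_smul, smul_eq_mul]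
  ring

variable (𝕜) in
/-- The convex cone of all `φ = p(1) t + p(log(1 + t))`. -/
def logPolyCone : ConvexCone ℝ (LipMap 𝕜) where
  carrier := {φ | ∃ p, IsLogPoly φ p}
  smul_mem' := by
    rintro c hc φ ⟨p, hp⟩
    refine ⟨c • p, ?_, ?_, ?_, fun t => ?_⟩
    · simp [hp.coeff_zero]
    · simpa using mul_pos hc hp.eval_one_pos
    · simpa using hp.mono.const_mul hc.le
    · rw [logPoly_smul, RCLike.ofReal_mul, ← hp.apply_eq, ← RCLike.real_smul_eq_coe_mul]
      rfl
  add_mem' := by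
    rintro φ ⟨p, hp⟩ ψ ⟨r, hr⟩
    refine ⟨p + r, ?_, ?_, ?_, fun t => ?_⟩
    · simp [hp.coeff_zero, hr.coeff_zero]
    · simpa using add_pos hp.eval_one_pos hr.eval_one_pos
    · simpa using hp.mono.add hr.mono
    · rw [logPoly_add, RCLike.ofReal_add, ← hp.apply_eq, ← hr.apply_eq]
      rfl

/-- The linear part gives the lower constant `p(1)`; the monotone part can only increase
differences. -/
theorem IsLogPoly.isBiLipschitz {φ : LipMap 𝕜} {p : ℝ[X]} (h : IsLogPoly φ p) :
    IsBiLipschitz φ := by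
  refine ⟨p.eval 1, h.eval_one_pos, fun s t => ?_⟩
  wlog hst : s ≤ t generalizing s t
  · rw [dist_comm s, dist_comm ((φ : ℝ≥0 → 𝕜) s)]
    exact this t s (le_of_not_ge hst)
  rw [dist_comm s, dist_comm ((φ : ℝ≥0 → 𝕜) s), h.apply_eq, h.apply_eq, dist_eq_norm,
    ← RCLike.ofReal_sub, RCLike.norm_ofReal, NNReal.dist_eq]
  have h1 := h.mono hst
  have hst' : (s : ℝ) ≤ t := hst
  rw [abs_of_nonneg (sub_nonneg.2 hst')]
  refine le_trans ?_ (le_abs_self _)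
  simp only [logPoly] at h1 ⊢
  linarith

theorem IsLogPoly.smul_sub_smul_ne_zero {φ ψ : LipMap 𝕜} {p r : ℝ[X]} (hp : IsLogPoly φ p)
    (hr : IsLogPoly ψ r) (hne : ∀ c : 𝕜, φ ≠ c • ψ) : r.eval 1 • p - p.eval 1 • r ≠ 0 := by
  intro h
  rw [sub_eq_zero] at h
  refine hne ((p.eval 1 / r.eval 1 : ℝ) : 𝕜) (Subtype.ext (funext fun t => ?_))
  change (φ : ℝ≥0 → 𝕜) t = _ * (ψ : ℝ≥0 → 𝕜) t
  rw [hp.apply_eq, hr.apply_eq, ← RCLike.ofReal_mul]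
  congr 1
  have h1 := congrArg (fun p => logPoly p (t : ℝ)) h
  simp only [logPoly_smul] at h1
  have h2 := hr.eval_one_pos.ne'
  field_simp
  linarith

/-! ### Separation of two functions -/

/-- First `m` is fixed with `|B F m - A G m| > D |A|`. Closeness of `l F` to `G` at a very large `n`
then nearly forces `l A = B`, which is incompatible with closeness at `m`. -/
theorem exists_two_points {F G σ : ℕ → ℝ} {A B : ℝ}
    (hσ : Filter.Tendsto σ Filter.atTop Filter.atTop)
    (hF : Filter.Tendsto (fun n => F n / σ n) Filter.atTop (𝓝 A))
    (hG : Filter.Tendsto (fun n => G n / σ n) Filter.atTop (𝓝 B))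
    (hFG : Filter.Tendsto (fun n => |B * F n - A * G n|) Filter.atTop Filter.atTop) (D : ℝ) :
    ∃ m n : ℕ, 1 ≤ m ∧ 1 ≤ n ∧ ∀ l : ℝ, |l * F m - G m| ≤ D → |l * F n - G n| ≤ D → False := by
  obtain ⟨m, hm1, hm⟩ := ((Filter.eventually_ge_atTop 1).and
    (hFG.eventually_gt_atTop (D * |A|))).exists
  have hinv : Filter.Tendsto (fun n => (σ n)⁻¹) Filter.atTop (𝓝 0) := hσ.inv_tendsto_atTop
  have h1 : Filter.Tendsto (fun n => |G n / σ n * F m - G m * (F n / σ n)|) Filter.atTop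
      (𝓝 |B * F m - G m * A|) := ((hG.mul_const _).sub (hF.const_mul _)).abs
  have h2 : Filter.Tendsto (fun n => D * (|F n / σ n| + |F m| * (σ n)⁻¹)) Filter.atTop
      (𝓝 (D * (|A| + |F m| * 0))) := (hF.abs.add (hinv.const_mul _)).const_mul _
  rw [mul_zero, add_zero] at h2
  rw [mul_comm (G m) A] at h1
  obtain ⟨n, hn1, hn, hσn⟩ := ((Filter.eventually_ge_atTop 1).and
    ((h2.eventually_lt h1 hm).and (hσ.eventually_gt_atTop 0))).exists
  refine ⟨m, n, hm1, hn1, fun l hlm hln => ?_⟩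
  have e1 : G n / σ n * F m - G m * (F n / σ n) =
      ((l * F m - G m) * F n - (l * F n - G n) * F m) / σ n := by
    field_simp
    ring
  have e2 : D * (|F n / σ n| + |F m| * (σ n)⁻¹) = (D * |F n| + D * |F m|) / σ n := by
    rw [abs_div, abs_of_pos hσn]
    field_simp
  rw [e1, e2, abs_div, abs_of_pos hσn, div_lt_div_iff_of_pos_right hσn] at hn
  have h3 := abs_sub ((l * F m - G m) * F n) ((l * F n - G n) * F m)
  rw [abs_mul, abs_mul] at h3
  have h4 := mul_le_mul_of_nonneg_right hlm (abs_nonneg (F n))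
  have h5 := mul_le_mul_of_nonneg_right hln (abs_nonneg (F m))
  linarith

/-! ### Non-embedding of the spaces of two maps of the cone -/

theorem tendsto_log_sqrt_nat :
    Filter.Tendsto (fun N : ℕ => Real.log √(N : ℝ)) Filter.atTop Filter.atTop :=
  Real.tendsto_log_atTop.comp (Real.tendsto_sqrt_atTop.comp tendsto_natCast_atTop_atTop)

/-- With `A = p(1)` and `B = r(1)`, the linear terms cancel in both uses of `exists_two_points`:
what remains is `B p(log(1+σ))` against a linear function, and `(B p - A r)(log(1+σ))` against `ψ`.
Both are unbounded, the polynomials being nonzero without constant term. -/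
theorem IsLogPoly.not_embedsInto {φ ψ : LipMap 𝕜} {p r : ℝ[X]} (hp : IsLogPoly φ p)
    (hr : IsLogPoly ψ r) (hpr : r.eval 1 • p - p.eval 1 • r ≠ 0) :
    ¬ EmbedsInto 𝕜 (Z φ) (Z ψ) := by
  intro hemb
  obtain ⟨c₀, D, hsep⟩ := exists_shift_approx hp.isBiLipschitz hr.isBiLipschitz hemb
  obtain ⟨-, K, hK⟩ := ψ.2
  set σ : ℕ → ℝ := fun N => Real.log √(N : ℝ)
  have hσ : Filter.Tendsto σ Filter.atTop Filter.atTop := tendsto_log_sqrt_nat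
  have hσ0 : ∀ N, 1 ≤ N → 0 ≤ σ N := fun N hN =>
    Real.log_nonneg (Real.one_le_sqrt.2 (by exact_mod_cast hN))
  set A := p.eval 1
  set B := r.eval 1
  have hA : 0 < A := hp.eval_one_pos
  have hB : 0 < B := hr.eval_one_pos
  have hp0 : p ≠ 0 := by
    rintro rfl
    simp [A] at hA
  have hLip : ∀ s t : ℝ, 0 ≤ s → 0 ≤ t → |logPoly r s - logPoly r t| ≤ K * |s - t| := by
    intro s t hs ht
    lift s to ℝ≥0 using hs
    lift t to ℝ≥0 using ht
    have := hK.dist_le_mul s t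
    rwa [hr.apply_eq, hr.apply_eq, dist_eq_norm, ← RCLike.ofReal_sub, RCLike.norm_ofReal,
      NNReal.dist_eq] at this
  have hr0 : logPoly r 0 = 0 := by
    simp [logPoly, ← coeff_zero_eq_eval_zero, hr.coeff_zero]
  set D' := 2 * |D| + K * |c₀| with hD'
  -- For large `c`, the function `ψ(s + c) - ψ(c)` is almost linear.
  obtain ⟨m, n, hm, hn, hmn⟩ := exists_two_points (F := fun N => logPoly p (σ N))
    (G := fun N => B * σ N) hσ ((tendsto_logPoly_div p).comp hσ)
    (tendsto_const_nhds (x := B) |>.congr' (by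
      filter_upwards [hσ.eventually_gt_atTop 0] with N hN
      field_simp))
    (by
      have h := ((tendsto_abs_eval_log hp.coeff_zero hp0).comp hσ).const_mul_atTop hB
      refine h.congr fun N => ?_
      simp only [Function.comp_apply, logPoly]
      rw [← abs_of_pos hB, ← abs_mul, abs_of_pos hB]
      congr 1
      ring) (D' + 1)
  have hlin : ∀ N, 1 ≤ N → ∀ᶠ c in Filter.atTop,
      |(logPoly r (σ N + c) - logPoly r c) - B * σ N| ≤ 1 := by
    intro N hN
    have h := (tendsto_eval_log_sub r (hσ0 N hN)).abs
    rw [abs_zero] at h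
    filter_upwards [h.eventually_le_const one_pos] with c hc
    refine le_trans (le_of_eq ?_) hc
    congr 1
    simp only [logPoly, B]
    ring
  obtain ⟨c₁, hc₁⟩ := Filter.eventually_atTop.1 ((hlin m hm).and (hlin n hn))
  -- For bounded `c`, it is within a bounded distance of `ψ`.
  obtain ⟨m', n', hm', hn', hmn'⟩ := exists_two_points (F := fun N => logPoly p (σ N))
    (G := fun N => logPoly r (σ N)) hσ ((tendsto_logPoly_div p).comp hσ)
    ((tendsto_logPoly_div r).comp hσ)
    (by
      refine ((tendsto_abs_eval_log (by simp [hp.coeff_zero, hr.coeff_zero]) hpr).comp hσ).congr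
        fun N => ?_
      simp only [Function.comp_apply, logPoly, eval_sub, eval_smul, smul_eq_mul]
      congr 1
      simp only [A, B]
      ring) (D' + 2 * K * |c₁|)
  -- The shift `c` is only known after `S`, so the test points for both ranges of `c` go in
  -- together; four points keep `√|S| ≤ 2`.
  set S : Finset ℕ := {m, n, m', n'} with hS
  obtain ⟨l, c, hc, hlc⟩ := hsep S (by simp [hS, hm, hn, hm', hn'])
  have hcard : √(S.card : ℝ) ≤ 2 := by
    rw [Real.sqrt_le_left (by norm_num)]
    exact_mod_cast Finset.card_le_four
  -- A negative `c` is at least `-c₀`, so replacing it by `0` costs at most `K |c₀|`, the second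
  -- term of `D'`.
  set d := max c 0 with hd
  have hd0 : 0 ≤ d := le_max_right _ _
  have key : ∀ N ∈ S, 1 ≤ N →
      |RCLike.re l * logPoly p (σ N) - (logPoly r (σ N + d) - logPoly r d)| ≤ D' := by
    intro N hN hN1
    have h1 := hlc N hN
    rw [hp.apply_eq, hr.apply_eq, hr.apply_eq, Real.coe_toNNReal _ (hσ0 N hN1),
      Real.coe_toNNReal', Real.coe_toNNReal', ← RCLike.ofReal_sub] at h1
    have h2 := (RCLike.abs_re_le_norm _).trans h1
    rw [map_sub, RCLike.re_mul_ofReal, RCLike.ofReal_re] at h2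
    have h3 : D * √(S.card : ℝ) ≤ 2 * |D| := by
      have := mul_le_mul (le_abs_self D) hcard (Real.sqrt_nonneg _) (abs_nonneg D)
      linarith
    have h4 := hLip (max (σ N + c) 0) (σ N + d) (le_max_right _ _) (add_nonneg (hσ0 N hN1) hd0)
    have h5 : |max (σ N + c) 0 - (σ N + d)| ≤ |c₀| := by
      have := hσ0 N hN1
      have := le_abs_self c₀
      have := abs_nonneg c₀
      rw [abs_le]
      rcases le_total c 0 with h | h
      · rw [hd, max_eq_right h]
        constructor
        · linarith [le_max_left (σ N + c) 0]
        · rw [add_zero, sub_le_iff_le_add]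
          exact max_le (by linarith) (by linarith)
      · rw [hd, max_eq_left h, max_eq_left (by linarith)]
        constructor <;> linarith
    have h6 : K * |max (σ N + c) 0 - (σ N + d)| ≤ K * |c₀| := by gcongr
    have e : RCLike.re l * logPoly p (σ N) - (logPoly r (σ N + d) - logPoly r d) =
      (RCLike.re l * logPoly p (σ N) - (logPoly r (max (σ N + c) 0) - logPoly r d)) +
        (logPoly r (max (σ N + c) 0) - logPoly r (σ N + d)) := by ring
    rw [e]
    refine (abs_add_le _ _).trans ?_
    linarith
  rcases le_total c₁ d with hcd | hcd
  · obtain ⟨hcm, hcn⟩ := hc₁ d hcd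
    refine hmn (RCLike.re l) ?_ ?_
    · have h := key m (by simp [hS]) hm
      have := (abs_sub_le _ _ _).trans (add_le_add h hcm)
      exact this
    · have h := key n (by simp [hS]) hn
      have := (abs_sub_le _ _ _).trans (add_le_add h hcn)
      exact this
  · have hbd : ∀ N, 1 ≤ N → |(logPoly r (σ N + d) - logPoly r d) - logPoly r (σ N)| ≤
        2 * K * |c₁| := by
      intro N hN
      have h1 := hLip (σ N + d) (σ N) (add_nonneg (hσ0 N hN) hd0) (hσ0 N hN)
      have h2 := hLip d 0 hd0 le_rfl
      rw [hr0, sub_zero, sub_zero] at h2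
      rw [add_sub_cancel_left] at h1
      have h3 : K * |d| ≤ K * |c₁| := by
        gcongr
      have e : (logPoly r (σ N + d) - logPoly r d) - logPoly r (σ N) =
        (logPoly r (σ N + d) - logPoly r (σ N)) - logPoly r d := by ring
      rw [e]
      refine (abs_sub _ _).trans ?_
      linarith
    refine hmn' (RCLike.re l) ?_ ?_
    · exact (abs_sub_le _ _ _).trans (add_le_add (key m' (by simp [hS]) hm') (hbd m' hm'))
    · exact (abs_sub_le _ _ _).trans (add_le_add (key n' (by simp [hS]) hn') (hbd n' hn'))

/-! ### The generators of the cone -/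

/-- The mean value inequality; the derivative is bounded because `x ^ n / n! ≤ exp x` at `x = log (1
+ u)`. -/
theorem abs_log_pow_sub_le (n : ℕ) {s t : ℝ} (hs : 0 ≤ s) (ht : 0 ≤ t) :
    |Real.log (1 + s) ^ (n + 1) - Real.log (1 + t) ^ (n + 1)| ≤
      (n + 1) * n.factorial * |s - t| := by
  have h := Convex.norm_image_sub_le_of_norm_hasDerivWithin_le (𝕜 := ℝ)
    (f := fun u : ℝ => Real.log (1 + u) ^ (n + 1))
    (f' := fun u => ((n + 1 : ℕ) : ℝ) * Real.log (1 + u) ^ n * (1 / (1 + u)))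
    (s := Set.Ici 0) (C := (n + 1) * n.factorial) (x := t) (y := s) (fun u hu => ?_)
    (fun u hu => ?_) (convex_Ici 0) ht hs
  · simpa using h
  · have hu : 0 ≤ u := hu
    have h1 : HasDerivAt (fun u : ℝ => 1 + u) 1 u := (hasDerivAt_id u).const_add 1
    exact ((h1.log (by linarith)).pow (n + 1)).hasDerivWithinAt
  · have hu : 0 ≤ u := hu
    have h0 : 0 ≤ Real.log (1 + u) := Real.log_nonneg (by linarith)
    have h1 := Real.pow_div_factorial_le_exp _ h0 n
    rw [Real.exp_log (by linarith), div_le_iff₀ (by positivity)] at h1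
    rw [Real.norm_eq_abs, abs_of_nonneg (by positivity), Nat.cast_add, Nat.cast_one, mul_assoc]
    gcongr
    rw [mul_one_div, div_le_iff₀ (by linarith)]
    linarith

variable (𝕜) in
/-- The function `t + log(1 + t)^(k+1)`. -/
def logPowMap (k : ℕ) : LipMap 𝕜 :=
  ⟨fun t => ((logPoly (X ^ (k + 1)) t : ℝ) : 𝕜), by simp [logPoly],
    Real.toNNReal (1 + (k + 1) * k.factorial), LipschitzWith.of_dist_le_mul fun s t => by
      rw [dist_eq_norm, ← RCLike.ofReal_sub, RCLike.norm_ofReal, NNReal.dist_eq,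
        Real.coe_toNNReal _ (by positivity)]
      have h := abs_log_pow_sub_le k s.2 t.2
      simp only [logPoly, eval_pow, eval_X, one_pow, one_mul]
      have e : (s : ℝ) + Real.log (1 + s) ^ (k + 1) - (t + Real.log (1 + t) ^ (k + 1)) =
        (s - t) + (Real.log (1 + s) ^ (k + 1) - Real.log (1 + t) ^ (k + 1)) := by ring
      rw [e, add_mul, one_mul]
      exact (abs_add_le _ _).trans (by gcongr; exact h)⟩

theorem logPowMap_apply (k : ℕ) (t : ℝ≥0) : (logPowMap 𝕜 k : ℝ≥0 → 𝕜) t =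
    (t : ℝ) + ((Real.log (1 + t) : ℝ) : 𝕜) ^ (k + 1) := by
  simp [logPowMap, logPoly]

theorem isLogPoly_logPowMap (k : ℕ) : IsLogPoly (logPowMap 𝕜 k) (X ^ (k + 1)) where
  coeff_zero := by simp
  eval_one_pos := by simp
  mono s t hst := by
    have hst' : (s : ℝ) ≤ t := hst
    have h0 : 0 ≤ Real.log (1 + s) := Real.log_nonneg (by linarith [s.2])
    simp only [eval_pow, eval_X]
    gcongr
  apply_eq _ := rfl

/-- A linear relation says `q(1) t + q(log(1+t)) = 0` for a polynomial `q` carrying the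
coefficients. Dividing by `t → ∞` gives `q(1) = 0`, and then `t = exp n - 1` makes every natural
number a root of `q`. -/
theorem linearIndependent_logPowMap : LinearIndependent 𝕜 (logPowMap 𝕜) := by
  rw [linearIndependent_iff']
  intro s a hsum k hk
  set q : 𝕜[X] := ∑ i ∈ s, monomial (i + 1) (a i) with hq
  have heval : ∀ t : ℝ≥0, q.eval 1 * (t : ℝ) + q.eval ((Real.log (1 + t) : ℝ) : 𝕜) = 0 := by
    intro t
    have h := congrArg (fun φ : LipMap 𝕜 => (φ : ℝ≥0 → 𝕜) t) hsum
    simp only [Submodule.coe_sum, Finset.sum_apply, Submodule.coe_smul, Pi.smul_apply,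
      logPowMap_apply, smul_eq_mul] at h
    rw [hq, eval_finsetSum, eval_finsetSum, Finset.sum_mul, ← Finset.sum_add_distrib]
    simp only [eval_monomial, one_pow, mul_one, ← mul_add]
    exact h
  have hq1 : q.eval 1 = 0 := by
    have h1 := (tendsto_eval_log_div q).const_add (q.eval 1)
    rw [add_zero] at h1
    refine tendsto_nhds_unique h1 (tendsto_const_nhds.congr' ?_)
    filter_upwards [Filter.eventually_gt_atTop 0] with t ht
    have h2 := heval ⟨t, ht.le⟩
    have ht' : (t : 𝕜) ≠ 0 := by exact_mod_cast ht.ne'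
    rw [eq_comm, ← mul_div_cancel_right₀ (q.eval 1) ht', ← add_div]
    exact (div_eq_zero_iff.2 (Or.inl h2))
  have hq0 : q = 0 := by
    refine q.eq_zero_of_infinite_isRoot ((Set.infinite_range_of_injective
      (f := fun n : ℕ => (n : 𝕜)) Nat.cast_injective).mono ?_)
    rintro _ ⟨n, rfl⟩
    have h2 := heval (Real.toNNReal (Real.exp n - 1))
    rw [hq1, zero_mul, zero_add, Real.coe_toNNReal _ (sub_nonneg.2
      (Real.one_le_exp (by positivity))), add_sub_cancel, Real.log_exp] at h2
    simpa using h2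
  have h := congrArg (fun q => q.coeff (k + 1)) hq0
  simpa [hq, finsetSum_coeff, coeff_monomial, hk] using h

end LogPoly

/-! ### The theorem -/

theorem exists_infiniteDimensional_cone (𝕜 : Type*) [RCLike 𝕜] :
    ∃ C : ConvexCone ℝ (LipMap 𝕜),
      IsInfiniteDimensionalCone C ∧
      (∀ φ ∈ C, IsBiLipschitz φ) ∧
      (∀ φ ∈ C, IsSingularTwistedHilbert φ) ∧
      (∀ φ ∈ C, ∀ ψ ∈ C, (∀ c : 𝕜, φ ≠ c • ψ) →
        Incomparable 𝕜 (Z φ) (Z ψ)) := by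
  have hle : ConvexCone.hull ℝ (Set.range (logPowMap 𝕜)) ≤ logPolyCone 𝕜 :=
    ConvexCone.hull_min (by
      rintro _ ⟨k, rfl⟩
      exact ⟨_, isLogPoly_logPowMap k⟩)
  have hbi : ∀ φ ∈ ConvexCone.hull ℝ (Set.range (logPowMap 𝕜)), IsBiLipschitz φ := fun φ hφ => by
    obtain ⟨p, hp⟩ := hle hφ
    exact hp.isBiLipschitz
  refine ⟨ConvexCone.hull ℝ (Set.range (logPowMap 𝕜)),
    ⟨_, Set.infinite_range_of_injective linearIndependent_logPowMap.injective,
      linearIndependent_logPowMap.linearIndepOn_id, rfl⟩, hbi,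
    fun φ hφ => isSingularTwistedHilbert_of_isBiLipschitz (hbi φ hφ),
    fun φ hφ ψ hψ hne => ?_⟩
  obtain ⟨p, hp⟩ := hle hφ
  obtain ⟨r, hr⟩ := hle hψ
  have hpr := hp.smul_sub_smul_ne_zero hr hne
  refine ⟨hp.not_embedsInto hr hpr, hr.not_embedsInto hp ?_⟩
  rw [← neg_sub]
  exact neg_ne_zero.2 hpr

end TwistedHilbert

end

theorem mainTheorem2 (𝕜 : Type*) [RCLike 𝕜] :
    ∃ C : ConvexCone ℝ (TwistedHilbert.LipMap 𝕜),
      TwistedHilbert.IsInfiniteDimensionalCone C ∧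
      (∀ φ ∈ C, TwistedHilbert.IsBiLipschitz φ) ∧
      (∀ φ ∈ C, TwistedHilbert.IsSingularTwistedHilbert φ) ∧
      (∀ φ ∈ C, ∀ ψ ∈ C, (∀ c : 𝕜, φ ≠ c • ψ) →
        TwistedHilbert.Incomparable 𝕜 (TwistedHilbert.Z φ) (TwistedHilbert.Z ψ)) :=
  TwistedHilbert.exists_infiniteDimensional_cone 𝕜
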